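/- Let $(\Sigma,h)$ be a smooth (finite-dimensional, Hausdorff, boundaryless, not necessarily connected) Riemannian manifold, let $V\in C^\infty(\Sigma)$ with $V>0$, and let $(M,g)=(\mathbb{R}\times\Sigma,\;V^2dt^2-h)$ be the corresponding standard static spacetime, time-oriented by $\partial/\partial t$. Put $\Sigma_0=\{0\}\times\Sigma$ and $T(t,p)=(-t,p)$, and for $p\in\Sigma$, $r\ge 0$ let $C(p,r)=\{q\in\Sigma : d(p,q)\le r\}$, where $d$ is the distance on $\Sigma$ induced by the Riemannian metric $V^{-2}h$ (with $d(p,q)=\infty$ if $p,q$ lie in different components). For $S\subseteq M$, let $D^+(S)$ (respectively $D^-(S)$) be the set of $x\in M$ such that every past-inextendible (respectively future-inextendible) future-pointing smooth causal curve through $x$ intersects $S$, where a curve is past- (future-) inextendible if it has no limit in $M$ as its parameter tends to the lower (upper) end of its interval of definition, i.e. it has no continuous extension there; let $D(S)=D^+(S)\cup D^-(S)$. Then: \begin{enumerate} \item $D^+(\Sigma_0)=\{(t,p)\in M : t\ge 0,\ C(p,t)\text{ is compact in }\Sigma\}$. \item $D^-(\Sigma_0)=\{(-t,p)\in M : t\ge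 0,\ C(p,t)\text{ is compact in }\Sigma\}=T D^+(\Sigma_0)$. \item $D(\Sigma_0)=D^+(\Sigma_0)\cup D^-(\Sigma_0)=\{(t,p)\in M : C(p,|t|)\text{ is compact in }\Sigma\}$. \item $D(\Sigma_0)$ is open in $M$. \end{enumerate} -/

import Mathlib

open Set Filter Topology Bundle
open scoped Manifold ContDiff

noncomputable section

/-! ### Causal curves and Cauchy developments of a Lorentzian manifold

`g` is the metric, of signature `(+, -, …, -)`, and `X` is the timelike vector field that gives
the time-orientation. -/

section Causality

variable {F : Type*} [NormedAddCommGroup F] [NormedSpace ℝ F]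
  {H : Type*} [TopologicalSpace H] (I : ModelWithCorners ℝ F H)
  {M : Type*} [TopologicalSpace M] [ChartedSpace H M]

/-- A tangent vector `v` at `x` is causal: it is nonzero and `g(v, v) ≥ 0`. -/
def IsCausalVector (g : ∀ x : M, LinearMap.BilinForm ℝ (TangentSpace I x))
    {x : M} (v : TangentSpace I x) : Prop :=
  v ≠ 0 ∧ 0 ≤ g x v v

/-- The curve `γ`, defined on the non-degenerate interval `J` of `ℝ`, is a smooth future-pointing
causal curve. Values of `γ` outside `J` are irrelevant, and at an endpoint of `J` that
belongs to `J` the velocity is the one-sided one. -/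
structure IsFutureCausalCurve
    (g : ∀ x : M, LinearMap.BilinForm ℝ (TangentSpace I x))
    (X : ∀ x : M, TangentSpace I x) (γ : ℝ → M) (J : Set ℝ) : Prop where
  ordConnected : J.OrdConnected
  nontrivial : J.Nontrivial
  smooth : ContMDiffOn 𝓘(ℝ, ℝ) I ∞ γ J
  causal : ∀ s ∈ J, IsCausalVector I g (mfderivWithin 𝓘(ℝ, ℝ) I γ J s 1)
  future : ∀ s ∈ J, 0 < g (γ s) (mfderivWithin 𝓘(ℝ, ℝ) I γ J s 1) (X (γ s))

/-- `γ : J → M` cannot be continuously extended to the past: `γ s` has no limit in `M` as `s`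
decreases to `inf J ∈ [-∞, ∞)`. (If `J` has a least element, the limit is the value there.) -/
def IsPastInextendible (γ : ℝ → M) (J : Set ℝ) : Prop :=
  ¬ ∃ q : M, Tendsto (fun s : J => γ s) atBot (𝓝 q)

/-- `γ : J → M` cannot be continuously extended to the future: `γ s` has no limit in `M` as `s`
increases to `sup J ∈ (-∞, ∞]`. -/
def IsFutureInextendible (γ : ℝ → M) (J : Set ℝ) : Prop :=
  ¬ ∃ q : M, Tendsto (fun s : J => γ s) atTop (𝓝 q)

/-- The future Cauchy development `D⁺(A)`: the points `x` such that every past-inextendible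
future-pointing smooth causal curve through `x` meets `A`. -/
def futureCauchyDevelopment
    (g : ∀ x : M, LinearMap.BilinForm ℝ (TangentSpace I x))
    (X : ∀ x : M, TangentSpace I x) (A : Set M) : Set M :=
  {x | ∀ (γ : ℝ → M) (J : Set ℝ), IsFutureCausalCurve I g X γ J → IsPastInextendible γ J →
    x ∈ γ '' J → (γ '' J ∩ A).Nonempty}

/-- The past Cauchy development `D⁻(A)`: the points `x` such that every future-inextendible
future-pointing smooth causal curve through `x` meets `A`. -/
def pastCauchyDevelopment
    (g : ∀ x : M, LinearMap.BilinForm ℝ (TangentSpace I x))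
    (X : ∀ x : M, TangentSpace I x) (A : Set M) : Set M :=
  {x | ∀ (γ : ℝ → M) (J : Set ℝ), IsFutureCausalCurve I g X γ J → IsFutureInextendible γ J →
    x ∈ γ '' J → (γ '' J ∩ A).Nonempty}

/-- The Cauchy development `D(A) = D⁺(A) ∪ D⁻(A)`. -/
def cauchyDevelopment
    (g : ∀ x : M, LinearMap.BilinForm ℝ (TangentSpace I x))
    (X : ∀ x : M, TangentSpace I x) (A : Set M) : Set M :=
  futureCauchyDevelopment I g X A ∪ pastCauchyDevelopment I g X A

end Causality

/-! ### Standard static spacetimes `(ℝ × S, V² dt² - h)` -/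

section Static

variable {E : Type*} [NormedAddCommGroup E] [NormedSpace ℝ E]
  {S : Type*} [TopologicalSpace S] [ChartedSpace E S] [IsManifold 𝓘(ℝ, E) ∞ S]

/-- The metric `g = V² dt² - h` of `ℝ × S`, that is
`g(v, w) = V(p)² dt(v) dt(w) - h_p(dπ₂ v, dπ₂ w)` for `v`, `w` tangent at `x = (t, p)`, where
`dt = dπ₁` and `π₁`, `π₂` are the projections of `ℝ × S`. -/
def staticMetric
    (h : ContMDiffRiemannianMetric 𝓘(ℝ, E) ∞ E (fun p : S => TangentSpace 𝓘(ℝ, E) p))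
    (V : S → ℝ) (x : ℝ × S) :
    LinearMap.BilinForm ℝ (TangentSpace (𝓘(ℝ, ℝ).prod 𝓘(ℝ, E)) x) :=
  let dt : TangentSpace (𝓘(ℝ, ℝ).prod 𝓘(ℝ, E)) x →L[ℝ] ℝ :=
    mfderiv (𝓘(ℝ, ℝ).prod 𝓘(ℝ, E)) 𝓘(ℝ, ℝ) (Prod.fst : ℝ × S → ℝ) x
  let dp : TangentSpace (𝓘(ℝ, ℝ).prod 𝓘(ℝ, E)) x →L[ℝ] TangentSpace 𝓘(ℝ, E) x.2 :=
    mfderiv (𝓘(ℝ, ℝ).prod 𝓘(ℝ, E)) 𝓘(ℝ, E) (Prod.snd : ℝ × S → S) x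
  LinearMap.mk₂ ℝ (fun v w => V x.2 ^ 2 * (dt v * dt w) - h.inner x.2 (dp v) (dp w))
    (fun v v' w => by simp only [map_add, _root_.add_apply]; ring)
    (fun c v w => by
      simp only [map_smul, _root_.smul_apply, smul_eq_mul]; ring)
    (fun v w w' => by simp only [map_add]; ring)
    (fun c v w => by simp only [map_smul, smul_eq_mul]; ring)

/-- The vector field `∂/∂t` on `ℝ × S`: at `(t, p)`, the velocity of `s ↦ (s, p)` at `s = t`. -/
def timeVectorField (x : ℝ × S) : TangentSpace (𝓘(ℝ, ℝ).prod 𝓘(ℝ, E)) x :=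
  mfderiv 𝓘(ℝ, ℝ) (𝓘(ℝ, ℝ).prod 𝓘(ℝ, E)) (fun s : ℝ => (s, x.2)) x.1 1

/-- The Riemannian metric `V⁻² h` on `S`. -/
def conformalMetric
    (h : ContMDiffRiemannianMetric 𝓘(ℝ, E) ∞ E (fun p : S => TangentSpace 𝓘(ℝ, E) p))
    (V : S → ℝ) (hV : ContMDiff 𝓘(ℝ, E) 𝓘(ℝ, ℝ) ∞ V) (hpos : ∀ p, 0 < V p) :
    ContMDiffRiemannianMetric 𝓘(ℝ, E) ∞ E (fun p : S => TangentSpace 𝓘(ℝ, E) p) where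
  inner p := (V p ^ 2)⁻¹ • h.inner p
  symm p v w := by simp [h.symm p v w]
  pos p v hv := by
    have h1 := h.pos p v hv
    have h2 := hpos p
    simp only [_root_.smul_apply, smul_eq_mul]
    positivity
  isVonNBounded p := by
    have h2 := hpos p
    refine ((h.isVonNBounded p).image
      (V p • ContinuousLinearMap.id ℝ (TangentSpace 𝓘(ℝ, E) p))).subset ?_
    intro v hv
    refine ⟨(V p)⁻¹ • v, ?_, ?_⟩
    · simp only [mem_ofPred_eq, _root_.smul_apply, smul_eq_mul, map_smul] at hv ⊢
      convert hv using 1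
      field_simp
    · simp [smul_smul, h2.ne']
  contMDiff :=
    ((hV.pow 2).inv₀ fun p => (pow_pos (hpos p) 2).ne').smul_section h.contMDiff

/-- The (extended) distance on `S` of the Riemannian metric `k`: the infimum of the `k`-lengths
of the curves that join two points, which is `∞` when there is none. -/
def metricEDist
    (k : ContMDiffRiemannianMetric 𝓘(ℝ, E) ∞ E (fun p : S => TangentSpace 𝓘(ℝ, E) p))
    (p q : S) : ENNReal :=
  letI : RiemannianBundle (fun p : S => TangentSpace 𝓘(ℝ, E) p) := ⟨k.toRiemannianMetric⟩
  Manifold.riemannianEDist 𝓘(ℝ, E) p q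

/-- The closed ball `C(p, r)` for the distance of the Riemannian metric `k`. -/
def metricClosedBall
    (k : ContMDiffRiemannianMetric 𝓘(ℝ, E) ∞ E (fun p : S => TangentSpace 𝓘(ℝ, E) p))
    (p : S) (r : ℝ) : Set S :=
  {q | metricEDist k p q ≤ ENNReal.ofReal r}

/-- The static hypersurface `S₀ = {0} × S`. -/
def zeroSlice (S : Type*) : Set (ℝ × S) := {x | x.1 = 0}

/-- The time reflection `T(t, p) = (-t, p)`. -/
def timeReflection {S : Type*} (x : ℝ × S) : ℝ × S := (-x.1, x.2)

end Static

end

/-! Write `k = V⁻²h`. A curve `(τ, c)` is future-pointing causal iff `τ' > 0` and `|c'|_k ≤ τ'`: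
time bounds the `k`-length of the spatial part. Everything reduces to the metric geometry of `(Σ,
k)`.

If `C(p, t)` is compact, consider a past-inextendible causal curve through `(t, p)` that avoids the
slice. Its time stays positive, so `τ` decreases to a limit; since distances along `c` are at most
differences of `τ`, `c` is Cauchy, and it eventually stays in `C(p, t)`. Hence the curve has a
limit, a contradiction (`mem_futureCauchyDevelopment_of_isCompact_metricClosedBall`).

If `C(p, t)` is not compact, let `R ≤ t` be the first radius at which the balls about `p` cease to
be compact. As in the Hopf-Rinow theorem there is a minimizing unit-speed ray `c` on `[0, R)`
without limit (`HasApproxIntermediatePoints.exists_ray`). The past-directed null curve over `c`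
starts at `(t, p)`, is past-inextendible, and keeps its time above `t - R ≥ 0`, so it misses the
slice. Points with `t < 0` are excluded by a vertical line.

Causal curves are required to be smooth, whereas the ray is obtained as a purely metric limit. The
bulk of the proof is therefore the regularity of minimizing curves
(`contMDiffOn_of_metricEDist_eq`). In a chart, minimality forces second differences of order `h ^ (3
/ 2)`, which gives `C¹`; the first variation and du Bois-Reymond's lemma give the geodesic equation;
bootstrapping it gives smoothness.

The past development follows by the time reflection combined with reversal of the parameter.
Openness holds because in a locally compact length space a compact closed ball can be enlarged
slightly and remain compact. -/

/-! ### Closed balls and minimizing rays in locally compact length spaces -/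

section LengthSpace

open Metric
open scoped ENNReal

variable {X : Type*} [EMetricSpace X]

/-- Approximate intermediate points exist between any two points. -/
def HasApproxIntermediatePoints (X : Type*) [EMetricSpace X] : Prop :=
  ∀ (x y : X) (r s : ℝ≥0∞), 0 < s → edist x y < r + s → ∃ z, edist x z ≤ r ∧ edist z y ≤ s

/-- A compact ball has a compact neighbourhood containing one of its thickenings, and a point only
slightly outside the ball is close to an intermediate point inside it. -/
lemma HasApproxIntermediatePoints.exists_isCompact_closedEBall_add [LocallyCompactSpace X]
    (hX : HasApproxIntermediatePoints X) {p : X} {r : ℝ≥0∞} (hr : r ≠ ⊤)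
    (h : IsCompact (closedEBall p r)) :
    ∃ δ : ℝ, 0 < δ ∧ IsCompact (closedEBall p (r + ENNReal.ofReal δ)) := by
  obtain ⟨K, hK, hKr⟩ := exists_compact_superset h
  obtain ⟨δ, hδ, hsub⟩ := h.exists_cthickening_subset_open isOpen_interior hKr
  -- Halving `δ` provides the strict inequality under which approximate intermediate points exist.
  refine ⟨δ / 2, half_pos hδ, hK.of_isClosed_subset isClosed_closedEBall fun x hx => ?_⟩
  have hlt : edist p x < r + ENNReal.ofReal δ := by
    rw [mem_closedEBall, edist_comm] at hx
    refine hx.trans_lt (ENNReal.add_lt_add_left hr ?_)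
    exact (ENNReal.ofReal_lt_ofReal_iff hδ).2 (half_lt_self hδ)
  obtain ⟨z, hz, hzx⟩ := hX p x r _ (ENNReal.ofReal_pos.2 hδ) hlt
  refine interior_subset (hsub ?_)
  rw [mem_cthickening_iff]
  exact (infEDist_le_edist_of_mem (by rwa [mem_closedEBall, edist_comm])).trans
    (by rwa [edist_comm])

/-- A point of the compact ball closest to `y` works: approximate intermediate points bound its
distance to `y` by `s + ε` for every `ε > 0`. -/
lemma HasApproxIntermediatePoints.exists_intermediate (hX : HasApproxIntermediatePoints X)
    {x y : X} {r s : ℝ≥0∞} (hs : s ≠ ⊤) (hr : r ≠ ⊤) (hc : IsCompact (closedEBall x r))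
    (h : edist x y ≤ r + s) : ∃ z, edist x z ≤ r ∧ edist z y ≤ s := by
  obtain ⟨z, hz, hmin⟩ := hc.exists_isMinOn ⟨x, by simp⟩
    (f := fun z => edist z y) (continuous_id.edist continuous_const).continuousOn
  refine ⟨z, by rwa [edist_comm], ENNReal.le_of_forall_pos_le_add fun ε hε _ => ?_⟩
  have hε' : (0 : ℝ≥0∞) < ε := by exact_mod_cast hε
  have hlt : edist x y < r + (s + ε) := by
    rw [← add_assoc]
    exact h.trans_lt (ENNReal.lt_add_right (by simp [hs, hr]) hε'.ne')
  obtain ⟨w, hw, hwy⟩ := hX x y r (s + ε) (by positivity) hlt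
  exact (hmin (by rwa [mem_closedEBall, edist_comm])).trans hwy

/-- A discrete substitute for a minimizing segment from `p` to `x`, which need not exist when `x` is
at distance `R`. Times are added in increasing order, each new point being intermediate between the
last one and `x`. -/
lemma HasApproxIntermediatePoints.exists_finite_chain (hX : HasApproxIntermediatePoints X)
    {p x : X} {R : ℝ} (hc : ∀ r < R, IsCompact (closedEBall p (ENNReal.ofReal r)))
    (hx : edist p x ≤ ENNReal.ofReal R) (F : Finset ℝ) (hF : ∀ s ∈ F, s ∈ Ioo 0 R) :
    ∃ f : ℝ → X, f 0 = p ∧ ∀ s ∈ insert 0 F, edist (f s) x ≤ ENNReal.ofReal (R - s) ∧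
      ∀ s' ∈ insert 0 F, edist (f s) (f s') ≤ ENNReal.ofReal |s - s'| := by
  classical
  induction F using Finset.induction_on_max with
  | empty => exact ⟨fun _ => p, rfl, by simpa using hx⟩
  | insert m F hm ih =>
    obtain ⟨f, hf0, hf⟩ := ih fun s hs => hF s (Finset.mem_insert_of_mem hs)
    have hmR := hF m (Finset.mem_insert_self _ _)
    set F0 : Finset ℝ := insert 0 F with hF0
    have hne : F0.Nonempty := ⟨0, Finset.mem_insert_self _ _⟩
    have hlt : ∀ s ∈ F0, s < m := fun s hs => by
      rcases Finset.mem_insert.1 hs with rfl | hs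
      · exact hmR.1
      · exact hm s hs
    set q := F0.max' hne
    have hq : q ∈ F0 := F0.max'_mem hne
    have hq0 : 0 ≤ q := F0.le_max' 0 (Finset.mem_insert_self _ _)
    have hqm := hlt q hq
    have hpq : edist p (f q) ≤ ENNReal.ofReal q := by
      have := (hf 0 (Finset.mem_insert_self _ _)).2 q hq
      rwa [hf0, zero_sub, abs_neg, abs_of_nonneg hq0] at this
    -- This ball lies in the ball of radius `m < R` about `p`, so an exact intermediate point exists
    -- in it.
    have hball : IsCompact (closedEBall (f q) (ENNReal.ofReal (m - q))) := by
      refine (hc m hmR.2).of_isClosed_subset isClosed_closedEBall fun z hz => ?_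
      rw [mem_closedEBall, edist_comm] at hz ⊢
      calc edist p z ≤ edist p (f q) + edist (f q) z := edist_triangle _ _ _
        _ ≤ ENNReal.ofReal q + ENNReal.ofReal (m - q) := add_le_add hpq hz
        _ = ENNReal.ofReal m := by
          rw [← ENNReal.ofReal_add hq0 (sub_nonneg.2 hqm.le)]; congr 1; ring
    obtain ⟨z, hz, hzx⟩ := hX.exists_intermediate (s := ENNReal.ofReal (R - m)) (y := x)
      ENNReal.ofReal_ne_top ENNReal.ofReal_ne_top hball <| by
        rw [← ENNReal.ofReal_add (sub_nonneg.2 hqm.le) (sub_nonneg.2 hmR.2.le)]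
        convert (hf q hq).1 using 2
        ring
    have hfm : ∀ s ∈ F0, edist (f s) z ≤ ENNReal.ofReal |s - m| := fun s hs => by
      have hsq : s ≤ q := F0.le_max' s hs
      calc edist (f s) z ≤ edist (f s) (f q) + edist (f q) z := edist_triangle _ _ _
        _ ≤ ENNReal.ofReal |s - q| + ENNReal.ofReal (m - q) := add_le_add ((hf s hs).2 q hq) hz
        _ = ENNReal.ofReal |s - m| := by
          rw [← ENNReal.ofReal_add (abs_nonneg _) (sub_nonneg.2 hqm.le)]
          rw [abs_of_nonpos (by linarith), abs_of_nonpos (by linarith)]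
          congr 1; ring
    have hup : ∀ s ∈ F0, Function.update f m z s = f s := fun s hs =>
      Function.update_of_ne (hlt s hs).ne _ _
    have hmem : ∀ s, s ∈ insert 0 (insert m F) → s = m ∨ s ∈ F0 := fun s hs => by
      simp only [hF0, Finset.mem_insert] at hs ⊢; tauto
    refine ⟨Function.update f m z, by rw [hup 0 (Finset.mem_insert_self _ _), hf0], ?_⟩
    intro s hs
    rcases hmem s hs with rfl | hsF
    · refine ⟨by simpa using hzx, fun s' hs' => ?_⟩
      rcases hmem s' hs' with rfl | hsF'
      · simp
      · rw [hup s' hsF', Function.update_self, edist_comm, abs_sub_comm]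
        exact hfm s' hsF'
    · rw [hup s hsF]
      refine ⟨(hf s hsF).1, fun s' hs' => ?_⟩
      rcases hmem s' hs' with rfl | hsF'
      · rw [Function.update_self]
        exact hfm s hsF
      · rw [hup s' hsF']
        exact (hf s hsF).2 s' hsF'

/-- If `R` is the first radius at which the closed balls around `p` cease to be compact, then a
minimizing ray of length `R` that does not converge starts at `p`. -/
theorem HasApproxIntermediatePoints.exists_ray [LocallyCompactSpace X]
    (hX : HasApproxIntermediatePoints X) {p : X} {R : ℝ} (hR : 0 < R)
    (hc : ∀ r < R, IsCompact (closedEBall p (ENNReal.ofReal r)))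
    (hnc : ¬ IsCompact (closedEBall p (ENNReal.ofReal R))) :
    ∃ c : ℝ → X, c 0 = p ∧
      (∀ s ∈ Ico 0 R, ∀ s' ∈ Ico 0 R, edist (c s) (c s') = ENNReal.ofReal |s - s'|) ∧
      ¬ ∃ q, Tendsto c (𝓝[<] R) (𝓝 q) := by
  classical
  -- Noncompactness yields an ultrafilter `𝒰` on the ball of radius `R` without a limit there. It
  -- plays the role of an ideal end point at which the ray is aimed.
  rw [isCompact_iff_ultrafilter_le_nhds] at hnc
  push Not at hnc
  obtain ⟨𝒰, h𝒰, h𝒰n⟩ := hnc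
  have hball : ∀ᶠ x in (𝒰 : Filter X), edist p x ≤ ENNReal.ofReal R := by
    filter_upwards [h𝒰 (mem_principal_self _)] with x hx
    rwa [edist_comm]
  -- finite chains from `p` towards `x`
  have hchain : ∀ (x : X) (F : Finset ℝ), ∃ f : ℝ → X, edist p x ≤ ENNReal.ofReal R →
      f 0 = p ∧ ∀ s ∈ F, s ∈ Ico 0 R → edist (f s) x ≤ ENNReal.ofReal (R - s) ∧
        ∀ s' ∈ F, s' ∈ Ico 0 R → edist (f s) (f s') ≤ ENNReal.ofReal |s - s'| := by
    intro x F
    by_cases hx : edist p x ≤ ENNReal.ofReal R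
    · obtain ⟨f, hf0, hf⟩ := hX.exists_finite_chain hc hx (F.filter (· ∈ Ioo 0 R))
        (fun s hs => (Finset.mem_filter.1 hs).2)
      have hmem : ∀ s ∈ F, s ∈ Ico 0 R → s ∈ insert 0 (F.filter (· ∈ Ioo 0 R)) := by
        intro s hs hsR
        rcases hsR.1.eq_or_lt with h | h
        · simp [← h]
        · exact Finset.mem_insert_of_mem (Finset.mem_filter.2 ⟨hs, h, hsR.2⟩)
      refine ⟨f, fun _ => ⟨hf0, fun s hs hsR => ⟨(hf s (hmem s hs hsR)).1, fun s' hs' hsR' =>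
        (hf s (hmem s hs hsR)).2 s' (hmem s' hs' hsR')⟩⟩⟩
    · exact ⟨fun _ => p, fun h => (hx h).elim⟩
  choose f hf using hchain
  -- Along `𝒲` the end point runs through `𝒰` while the finite set of times eventually contains any
  -- given time, so all points of the ray arise as limits along one ultrafilter.
  let 𝒲 : Ultrafilter (X × Finset ℝ) := Ultrafilter.of ((𝒰 : Filter X) ×ˢ atTop)
  have h𝒲 : (𝒲 : Filter (X × Finset ℝ)) ≤ (𝒰 : Filter X) ×ˢ atTop := Ultrafilter.of_le _
  have hfst : Tendsto Prod.fst (𝒲 : Filter (X × Finset ℝ)) 𝒰 := tendsto_fst.mono_left h𝒲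
  have hsnd : Tendsto Prod.snd (𝒲 : Filter (X × Finset ℝ)) atTop := tendsto_snd.mono_left h𝒲
  have hb : ∀ᶠ w in (𝒲 : Filter (X × Finset ℝ)), edist p w.1 ≤ ENNReal.ofReal R :=
    hfst.eventually hball
  have hin : ∀ s : ℝ, ∀ᶠ w in (𝒲 : Filter (X × Finset ℝ)), s ∈ w.2 := fun s => by
    filter_upwards [hsnd.eventually (eventually_ge_atTop {s})] with w hw
    exact hw (by simp)
  have hto : ∀ s ∈ Ico 0 R, ∀ᶠ w in (𝒲 : Filter (X × Finset ℝ)),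
      edist (f w.1 w.2 s) w.1 ≤ ENNReal.ofReal (R - s) := fun s hs => by
    filter_upwards [hb, hin s] with w hw hsw using (((hf w.1 w.2 hw).2 s hsw) hs).1
  have hlip : ∀ s ∈ Ico 0 R, ∀ s' ∈ Ico 0 R, ∀ᶠ w in (𝒲 : Filter (X × Finset ℝ)),
      edist (f w.1 w.2 s) (f w.1 w.2 s') ≤ ENNReal.ofReal |s - s'| := fun s hs s' hs' => by
    filter_upwards [hb, hin s, hin s'] with w hw hsw hsw' using
      (((hf w.1 w.2 hw).2 s hsw) hs).2 s' hsw' hs'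
  have hzero : ∀ᶠ w in (𝒲 : Filter (X × Finset ℝ)), f w.1 w.2 0 = p := by
    filter_upwards [hb] with w hw using (hf w.1 w.2 hw).1
  have h0R : (0 : ℝ) ∈ Ico 0 R := ⟨le_rfl, hR⟩
  have hlim : ∀ s ∈ Ico 0 R, ∃ y, Tendsto (fun w : X × Finset ℝ => f w.1 w.2 s) 𝒲 (𝓝 y) := by
    intro s hs
    have hle : ((𝒲.map fun w => f w.1 w.2 s : Ultrafilter X) : Filter X) ≤
        𝓟 (closedEBall p (ENNReal.ofReal s)) := by
      rw [le_principal_iff, Ultrafilter.coe_map, Filter.mem_map]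
      filter_upwards [hlip s hs 0 h0R, hzero] with w hw hw0
      rw [mem_preimage, mem_closedEBall]
      rwa [hw0, sub_zero, abs_of_nonneg hs.1] at hw
    obtain ⟨y, -, hy⟩ := isCompact_iff_ultrafilter_le_nhds.1 (hc s hs.2) _ hle
    exact ⟨y, hy⟩
  have : Nonempty X := ⟨p⟩
  choose! c hcl using hlim
  have hc0 : c 0 = p := by
    refine tendsto_nhds_unique (hcl 0 h0R) (tendsto_const_nhds.congr' ?_)
    filter_upwards [hzero] with w hw using hw.symm
  have hclip : ∀ s ∈ Ico 0 R, ∀ s' ∈ Ico 0 R, edist (c s) (c s') ≤ ENNReal.ofReal |s - s'| :=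
    fun s hs s' hs' => le_of_tendsto ((hcl s hs).edist (hcl s' hs')) (hlip s hs s' hs')
  -- points of `𝒰` leave every smaller ball
  have hfar : ∀ r < R, ∀ᶠ x in (𝒰 : Filter X), ENNReal.ofReal r < edist p x := by
    intro r hr
    by_contra hcon
    have hle : ∀ᶠ x in (𝒰 : Filter X), edist p x ≤ ENNReal.ofReal r := by
      have := 𝒰.eventually_not.2 hcon
      filter_upwards [this] with x hx using not_lt.1 hx
    obtain ⟨y, hy, hy'⟩ := isCompact_iff_ultrafilter_le_nhds.1 (hc r hr) 𝒰 (by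
      rw [le_principal_iff]
      filter_upwards [hle] with x hx
      rwa [mem_closedEBall, edist_comm])
    exact h𝒰n y (closedEBall_subset_closedEBall (ENNReal.ofReal_le_ofReal hr.le) hy) hy'
  -- The end points `x` are eventually farther from `p` than any radius below `R`, and the chain
  -- point at time `s` is within `R - s` of `x`; so it cannot be closer to `p` than `s` in the
  -- limit. With the Lipschitz bound this makes the ray minimizing.
  have hrad : ∀ s ∈ Ico 0 R, ENNReal.ofReal s ≤ edist p (c s) := by
    intro s hs
    rcases hs.1.eq_or_lt with h | hs0
    · simp [← h]
    refine le_of_forall_lt fun a ha => ?_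
    have ha' : a ≠ ⊤ := ha.ne_top
    obtain ⟨a, rfl⟩ : ∃ b : ℝ, ENNReal.ofReal b = a := ⟨a.toReal, ENNReal.ofReal_toReal ha'⟩
    rw [ENNReal.ofReal_lt_ofReal_iff hs0] at ha
    obtain ⟨b, hab, hbs⟩ := exists_between (max_lt ha hs0)
    have hb0 : 0 < b := (le_max_right a 0).trans_lt hab
    refine ((ENNReal.ofReal_lt_ofReal_iff hb0).2 ((le_max_left _ _).trans_lt hab)).trans_le ?_
    refine ge_of_tendsto ((tendsto_const_nhds (x := p)).edist (hcl s hs)) ?_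
    filter_upwards [hto s hs, hfst.eventually (hfar (b + (R - s)) (by linarith))] with w hw hw'
    have h1 : ENNReal.ofReal b + ENNReal.ofReal (R - s) ≤
        edist p (f w.1 w.2 s) + ENNReal.ofReal (R - s) := by
      rw [← ENNReal.ofReal_add hb0.le (by linarith [hs.2])]
      exact hw'.le.trans ((edist_triangle _ (f w.1 w.2 s) _).trans (by gcongr))
    exact (ENNReal.add_le_add_iff_right ENNReal.ofReal_ne_top).1 h1
  refine ⟨c, hc0, ?_, ?_⟩
  · have key : ∀ s ∈ Ico 0 R, ∀ s' ∈ Ico 0 R, s ≤ s' →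
        edist (c s) (c s') = ENNReal.ofReal |s - s'| := by
      intro s hs s' hs' hss
      refine le_antisymm (hclip s hs s' hs') ?_
      have h1 : edist p (c s) ≤ ENNReal.ofReal s := by
        have := hclip 0 h0R s hs
        rwa [hc0, zero_sub, abs_neg, abs_of_nonneg hs.1] at this
      have h2 : ENNReal.ofReal s + ENNReal.ofReal |s - s'| ≤
          ENNReal.ofReal s + edist (c s) (c s') := by
        rw [← ENNReal.ofReal_add hs.1 (abs_nonneg _), abs_of_nonpos (by linarith)]
        calc ENNReal.ofReal (s + -(s - s')) = ENNReal.ofReal s' := by congr 1; ring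
          _ ≤ edist p (c s') := hrad s' hs'
          _ ≤ _ := (edist_triangle _ (c s) _).trans (by gcongr)
      exact (ENNReal.add_le_add_iff_left ENNReal.ofReal_ne_top).1 h2
    intro s hs s' hs'
    rcases le_total s s' with h | h
    · exact key s hs s' hs' h
    · rw [edist_comm, abs_sub_comm]; exact key s' hs' s hs h
  -- If the ray converged to `q`, the points of `𝒰` would eventually lie within `3δ` of `q`, hence
  -- in a compact neighbourhood of `q`, and `𝒰` would have a limit.
  · rintro ⟨q, hq⟩
    obtain ⟨K, hK, hKq⟩ := exists_compact_mem_nhds q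
    obtain ⟨ε, hε, hεK⟩ := Metric.nhds_basis_closedEBall.mem_iff.1 hKq
    obtain ⟨δ, hδ, hδε⟩ : ∃ δ : ℝ, 0 < δ ∧ 3 * ENNReal.ofReal δ ≤ ε := by
      rcases eq_or_ne ε ⊤ with rfl | hε'
      · exact ⟨1, one_pos, le_top⟩
      · refine ⟨ε.toReal / 3, div_pos (ENNReal.toReal_pos hε.ne' hε') (by norm_num), ?_⟩
        rw [show (3 : ℝ≥0∞) = ENNReal.ofReal 3 by simp, ← ENNReal.ofReal_mul (by norm_num),
          mul_div_cancel₀ _ (by norm_num : (3 : ℝ) ≠ 0), ENNReal.ofReal_toReal hε']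
    have hδ' : 0 < ENNReal.ofReal δ := ENNReal.ofReal_pos.2 hδ
    have hnear : ∀ᶠ s in 𝓝[<] R, edist (c s) q ≤ ENNReal.ofReal δ :=
      hq.eventually (Metric.closedEBall_mem_nhds q hδ')
    have hnear2 : ∀ᶠ s in 𝓝[<] R, s ∈ Ioo (max 0 (R - δ)) R :=
      Ioo_mem_nhdsLT (max_lt hR (by linarith))
    obtain ⟨s, hsq, hs⟩ := (hnear.and hnear2).exists
    have hsR : s ∈ Ico 0 R := ⟨(le_max_left _ _).trans hs.1.le, hs.2⟩
    have hsδ : R - s ≤ δ := by have := (le_max_right 0 (R - δ)).trans_lt hs.1; linarith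
    have h1 : ∀ᶠ w in (𝒲 : Filter (X × Finset ℝ)), w.1 ∈ K := by
      filter_upwards [hto s hsR, (hcl s hsR).eventually (Metric.closedEBall_mem_nhds (c s) hδ')]
        with w hw hw'
      refine hεK (le_trans ?_ hδε)
      calc edist w.1 q ≤ edist w.1 (f w.1 w.2 s) + edist (f w.1 w.2 s) (c s) + edist (c s) q :=
            edist_triangle4 _ _ _ _
        _ ≤ ENNReal.ofReal δ + ENNReal.ofReal δ + ENNReal.ofReal δ := by
          gcongr
          · rw [edist_comm]; exact hw.trans (ENNReal.ofReal_le_ofReal hsδ)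
        _ = 3 * ENNReal.ofReal δ := by ring
    have h2 : K ∈ (𝒰 : Filter X) := by
      by_contra hn
      have h3 : ∀ᶠ w in (𝒲 : Filter (X × Finset ℝ)), w.1 ∈ Kᶜ :=
        hfst.eventually (Ultrafilter.compl_mem_iff_notMem.2 hn)
      obtain ⟨w, hw, hw'⟩ := (h1.and h3).exists
      exact hw' hw
    obtain ⟨y, -, hy⟩ := isCompact_iff_ultrafilter_le_nhds.1 hK 𝒰 (le_principal_iff.2 h2)
    exact h𝒰n y (isClosed_closedEBall.mem_of_tendsto hy (h𝒰 (mem_principal_self _))) hy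

/-- The first radius at which the closed balls around `p` cease to be compact. -/
lemma HasApproxIntermediatePoints.exists_first_noncompact_radius [LocallyCompactSpace X]
    (hX : HasApproxIntermediatePoints X) {p : X} {t : ℝ}
    (hnc : ¬ IsCompact (closedEBall p (ENNReal.ofReal t))) :
    ∃ R, 0 < R ∧ R ≤ t ∧ (∀ r < R, IsCompact (closedEBall p (ENNReal.ofReal r))) ∧
      ¬ IsCompact (closedEBall p (ENNReal.ofReal R)) := by
  have hmono : ∀ r s, r ≤ s → IsCompact (closedEBall p (ENNReal.ofReal s)) →
      IsCompact (closedEBall p (ENNReal.ofReal r)) := fun r s hrs hs =>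
    hs.of_isClosed_subset isClosed_closedEBall
      (closedEBall_subset_closedEBall (ENNReal.ofReal_le_ofReal hrs))
  set A : Set ℝ := {r | ¬ IsCompact (closedEBall p (ENNReal.ofReal r))} with hA
  have h0 : ∀ r ≤ 0, IsCompact (closedEBall p (ENNReal.ofReal r)) := fun r hr => by
    rw [ENNReal.ofReal_of_nonpos hr, closedEBall_zero]
    exact isCompact_singleton
  have hpos : ∀ r ∈ A, 0 ≤ r := fun r hr => by
    by_contra h
    exact hr (h0 r (not_le.1 h).le)
  have hbdd : BddBelow A := ⟨0, hpos⟩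
  have hlt : ∀ r < sInf A, IsCompact (closedEBall p (ENNReal.ofReal r)) := fun r hr => by
    by_contra h
    exact (csInf_le hbdd h).not_gt hr
  -- The infimum is itself a noncompact radius, since compactness at it would persist for slightly
  -- larger radii.
  have hR : ¬ IsCompact (closedEBall p (ENNReal.ofReal (sInf A))) := by
    intro h
    obtain ⟨δ, hδ, hc⟩ := hX.exists_isCompact_closedEBall_add ENNReal.ofReal_ne_top h
    have h0 : 0 ≤ sInf A := Real.sInf_nonneg hpos
    rw [← ENNReal.ofReal_add h0 hδ.le] at hc
    obtain ⟨r, hr, hrδ⟩ := (csInf_lt_iff hbdd ⟨t, hnc⟩).1 (lt_add_of_pos_right (sInf A) hδ)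
    exact hr (hmono _ _ hrδ.le hc)
  refine ⟨sInf A, ?_, csInf_le hbdd hnc, hlt, hR⟩
  by_contra h
  exact hR (h0 _ (not_lt.1 h))

/-- Compactness of the closed balls is an open condition on the centre and the radius. -/
lemma HasApproxIntermediatePoints.isOpen_setOf_isCompact_closedEBall [LocallyCompactSpace X]
    (hX : HasApproxIntermediatePoints X) :
    IsOpen {x : ℝ × X | IsCompact (closedEBall x.2 (ENNReal.ofReal |x.1|))} := by
  rw [isOpen_iff_mem_nhds]
  rintro ⟨t, p⟩ htp
  obtain ⟨δ, hδ, hc⟩ := hX.exists_isCompact_closedEBall_add ENNReal.ofReal_ne_top htp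
  have hδ2 : 0 < δ / 2 := half_pos hδ
  have h1 : ∀ᶠ x : ℝ × X in 𝓝 (t, p), |x.1| < |t| + δ / 2 :=
    (continuous_abs.comp continuous_fst).continuousAt.eventually_lt_const
      (by simpa using hδ2)
  have h2 : ∀ᶠ x : ℝ × X in 𝓝 (t, p), edist x.2 p ≤ ENNReal.ofReal (δ / 2) :=
    (continuous_snd.tendsto (t, p)).eventually
      (Metric.closedEBall_mem_nhds p (ENNReal.ofReal_pos.2 hδ2))
  filter_upwards [h1, h2] with x hx1 hx2
  refine hc.of_isClosed_subset isClosed_closedEBall fun y hy => ?_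
  calc edist y p ≤ edist y x.2 + edist x.2 p := edist_triangle _ _ _
    _ ≤ ENNReal.ofReal (|t| + δ / 2) + ENNReal.ofReal (δ / 2) :=
      add_le_add (le_trans hy (ENNReal.ofReal_le_ofReal hx1.le)) hx2
    _ = ENNReal.ofReal |t| + ENNReal.ofReal δ := by
      rw [← ENNReal.ofReal_add (by positivity) hδ2.le,
        ← ENNReal.ofReal_add (abs_nonneg _) hδ.le]
      congr 1; ring

end LengthSpace


/-! ### Integrals with a parameter, du Bois-Reymond's lemma, second differences -/

section Calculus

open MeasureTheory

variable {E : Type*} [NormedAddCommGroup E] [NormedSpace ℝ E]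

/-- Extension by the end values, so that integrands on a compact interval may be taken continuous on
the whole line without leaving the image of the curve. -/
lemma ContinuousOn.exists_continuous_eqOn_Icc {X : Type*} [TopologicalSpace X] {u : ℝ → X}
    {a b : ℝ} (hab : a ≤ b) (hu : ContinuousOn u (Icc a b)) :
    ∃ U : ℝ → X, Continuous U ∧ (∀ s ∈ Icc a b, U s = u s) ∧ ∀ s, U s ∈ u '' Icc a b :=
  ⟨fun s => u (projIcc a b hab s),
    hu.comp_continuous (by fun_prop) fun s => (projIcc a b hab s).2,
    fun s hs => by simp only [projIcc_of_mem hab hs],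
    fun s => mem_image_of_mem u (projIcc a b hab s).2⟩

lemma hasDerivAt_intervalIntegral_of_continuousOn {F F' : ℝ → ℝ → E} {a b δ : ℝ} (hab : a ≤ b)
    (hδ : 0 < δ) (hF : ContinuousOn (Function.uncurry F) (Icc (-δ) δ ×ˢ Icc a b))
    (hF' : ContinuousOn (Function.uncurry F') (Icc (-δ) δ ×ˢ Icc a b))
    (hd : ∀ t ∈ Icc a b, ∀ ε ∈ Ioo (-δ) δ, HasDerivAt (fun x => F x t) (F' ε t) ε) :
    HasDerivAt (fun x => ∫ t in a..b, F x t) (∫ t in a..b, F' 0 t) 0 := by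
  obtain ⟨C, hC⟩ := (isCompact_Icc.prod isCompact_Icc).exists_bound_of_continuousOn hF'
  have hsec : ∀ G : ℝ → ℝ → E, ContinuousOn (Function.uncurry G) (Icc (-δ) δ ×ˢ Icc a b) →
      ∀ ε ∈ Icc (-δ) δ, ContinuousOn (G ε) (Icc a b) := fun G hG ε hε =>
    hG.comp (f := fun t => (ε, t)) (by fun_prop) fun t ht => ⟨hε, ht⟩
  have hint : ∀ G : ℝ → ℝ → E, ContinuousOn (Function.uncurry G) (Icc (-δ) δ ×ˢ Icc a b) →
      ∀ ε ∈ Icc (-δ) δ, IntervalIntegrable (G ε) volume a b := fun G hG ε hε =>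
    (hsec G hG ε hε).intervalIntegrable_of_Icc hab
  have h0 : (0 : ℝ) ∈ Icc (-δ) δ := ⟨by linarith, hδ.le⟩
  have hmem : ∀ t, t ∈ uIoc a b → t ∈ Icc a b := fun t ht => by
    rw [uIoc_of_le hab] at ht
    exact ⟨ht.1.le, ht.2⟩
  refine (intervalIntegral.hasDerivAt_integral_of_dominated_loc_of_deriv_le
    (s := Ioo (-δ) δ) (bound := fun _ => C) (F' := F') (Ioo_mem_nhds (by linarith) hδ) ?_
    (hint F hF 0 h0) ((hint F' hF' 0 h0).def'.aestronglyMeasurable) ?_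
    intervalIntegrable_const ?_).2
  · filter_upwards [Icc_mem_nhds (by linarith : -δ < 0) hδ] with ε hε using
      (hint F hF ε hε).def'.aestronglyMeasurable
  · exact Eventually.of_forall fun t ht ε hε => hC (ε, t) ⟨Ioo_subset_Icc_self hε, hmem t ht⟩
  · exact Eventually.of_forall fun t ht ε hε => hd t (hmem t ht) ε hε

/-- The lemma of du Bois-Reymond. -/
lemma eq_const_add_integral_of_forall_integral_eq_zero {P Q : ℝ → ℝ} {a b : ℝ} (hab : a < b)
    (hP : Continuous P) (hQ : Continuous Q)
    (h : ∀ f f' : ℝ → ℝ, (∀ t, HasDerivAt f (f' t) t) → Continuous f' → f a = 0 → f b = 0 →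
      ∫ t in a..b, (Q t * f t + P t * f' t) = 0) :
    ∃ c, ∀ t ∈ Icc a b, P t = c + ∫ x in a..t, Q x := by
  set Φ : ℝ → ℝ := fun t => ∫ x in a..t, Q x with hΦ
  have hΦd : ∀ t, HasDerivAt Φ (Q t) t := fun t =>
    intervalIntegral.integral_hasDerivAt_right (hQ.intervalIntegrable _ _)
      hQ.stronglyMeasurable.stronglyMeasurableAtFilter hQ.continuousAt
  have hΦc : Continuous Φ := continuous_iff_continuousAt.2 fun t => (hΦd t).continuousAt
  -- Subtracting the mean makes the primitive `f` of `g = P - Φ - μ` vanish at both ends. Testing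
  -- with this `f`, and integrating `Q f` by parts, gives `∫ g² = 0`.
  set μ : ℝ := (b - a)⁻¹ * ∫ t in a..b, (P t - Φ t) with hμ
  set g : ℝ → ℝ := fun t => P t - Φ t - μ with hg
  have hgc : Continuous g := by fun_prop
  set f : ℝ → ℝ := fun t => ∫ x in a..t, g x with hf
  have hfd : ∀ t, HasDerivAt f (g t) t := fun t =>
    intervalIntegral.integral_hasDerivAt_right (hgc.intervalIntegrable _ _)
      hgc.stronglyMeasurable.stronglyMeasurableAtFilter hgc.continuousAt
  have hfc : Continuous f := continuous_iff_continuousAt.2 fun t => (hfd t).continuousAt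
  have hfa : f a = 0 := by simp [hf]
  have hfb : f b = 0 := by
    change ∫ t in a..b, ((P t - Φ t) - μ) = 0
    rw [intervalIntegral.integral_sub (f := fun t => P t - Φ t)
      ((hP.sub hΦc).intervalIntegrable _ _)
      intervalIntegrable_const, intervalIntegral.integral_const, hμ, smul_eq_mul,
      mul_inv_cancel_left₀ (sub_ne_zero.2 hab.ne'), sub_self]
  have h1 := h f g hfd hgc hfa hfb
  have h2 : ∫ t in a..b, (Q t * f t + Φ t * g t) = 0 := by
    rw [intervalIntegral.integral_deriv_mul_eq_sub (fun x _ => hΦd x) (fun x _ => hfd x)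
      (hQ.intervalIntegrable _ _) (hgc.intervalIntegrable _ _), hfa, hfb]
    simp
  have h3 : ∫ t in a..b, g t ^ 2 = 0 := by
    have e : (fun t => g t ^ 2) =
        fun t => (Q t * f t + P t * g t) - (Q t * f t + Φ t * g t) - μ * g t := by
      funext t; simp only [hg]; ring
    rw [e, intervalIntegral.integral_sub (Continuous.intervalIntegrable (by fun_prop) _ _)
      (Continuous.intervalIntegrable (by fun_prop) _ _),
      intervalIntegral.integral_sub (Continuous.intervalIntegrable (by fun_prop) _ _)
      (Continuous.intervalIntegrable (by fun_prop) _ _), h1, h2,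
      intervalIntegral.integral_const_mul]
    change 0 - 0 - μ * f b = 0
    simp [hfb]
  refine ⟨μ, fun t ht => ?_⟩
  have h4 : g t = 0 := by
    by_contra hne
    exact (intervalIntegral.integral_pos (f := fun t => g t ^ 2) hab (by fun_prop)
      (fun x _ => sq_nonneg _) ⟨t, ht, by positivity⟩).ne' h3
  simp only [hg] at h4
  linarith

/-- A continuous curve whose second differences are `O(h ^ (3 / 2))` is continuously
differentiable. -/
theorem contDiffOn_one_of_second_difference_le [CompleteSpace E] {u : ℝ → E} {a b b' C : ℝ}
    (hab : a ≤ b') (hb : b' < b) (hu : ContinuousOn u (Icc a b))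
    (h : ∀ s k, 0 < k → a ≤ s → s + 2 * k ≤ b →
      ‖u (s + 2 * k) - (2 : ℝ) • u (s + k) + u s‖ ≤ C * (k * √k)) :
    ContDiffOn ℝ 1 u (Icc a b') := by
  rcases hab.eq_or_lt with rfl | hab'
  · rw [Icc_self]
    exact fun x hx => by
      rw [mem_singleton_iff.1 hx]
      exact contDiffWithinAt_singleton
  have hab0 : a ≤ b := hab.trans hb.le
  obtain ⟨U, hUc, hUu, -⟩ := hu.exists_continuous_eqOn_Icc hab0
  -- All increments are at most `b - b'`, so `s + k n` stays in `[a, b]` for `s ≤ b'`; this is why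
  -- regularity is only claimed up to `b'`.
  set η := b - b' with hη
  have hη0 : 0 < η := sub_pos.2 hb
  set k : ℕ → ℝ := fun n => η * (1 / 2) ^ n with hk
  have hk0 : ∀ n, 0 < k n := fun n => by positivity
  have hkη : ∀ n, k n ≤ η := fun n =>
    mul_le_of_le_one_right hη0.le (pow_le_one₀ (by norm_num) (by norm_num))
  have hks : ∀ n, k n = 2 * k (n + 1) := fun n => by simp only [hk, pow_succ]; ring
  set r : ℝ := √(1 / 2) with hr
  have hr1 : r < 1 := by rw [hr, Real.sqrt_lt' one_pos]; norm_num
  have hkr : ∀ n, √(k n) = √η * r ^ n := fun n => by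
    have e : ((1 : ℝ) / 2) ^ n = (r ^ n) ^ 2 := by
      rw [← pow_mul, mul_comm n, pow_mul, Real.sq_sqrt (by norm_num)]
    rw [hk, Real.sqrt_mul hη0.le, e, Real.sqrt_sq (by positivity)]
  -- Consecutive dyadic difference quotients differ by a second difference divided by `2k`, hence by
  -- `O(√k)`. This is a geometric series of ratio `√(1/2)`, so the quotients converge uniformly.
  set q : ℕ → ℝ → E := fun n s => (k n)⁻¹ • (U (s + k n) - U s) with hq
  have hqc : ∀ n, Continuous (q n) := fun n => by fun_prop
  have hstep : ∀ s ∈ Icc a b', ∀ n, dist (q n s) (q (n + 1) s) ≤ (|C| * √η) * r ^ n := by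
    intro s hs n
    have hk1 := hk0 (n + 1)
    have hsb : s + 2 * k (n + 1) ≤ b := by
      have := hkη n
      rw [← hks n]; linarith [hs.2]
    have e : q n s - q (n + 1) s = (2 * k (n + 1))⁻¹ •
        (u (s + 2 * k (n + 1)) - (2 : ℝ) • u (s + k (n + 1)) + u s) := by
      simp only [hq]
      rw [hks n, hUu s ⟨hs.1, hs.2.trans hb.le⟩, hUu _ ⟨by linarith [hs.1], hsb⟩,
        hUu (s + k (n + 1)) ⟨by linarith [hs.1], by linarith⟩]
      have : (k (n + 1))⁻¹ = (2 * k (n + 1))⁻¹ * 2 := by field_simp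
      rw [this, mul_smul]
      module
    rw [dist_eq_norm, e, norm_smul, Real.norm_of_nonneg (by positivity)]
    calc (2 * k (n + 1))⁻¹ * ‖u (s + 2 * k (n + 1)) - (2 : ℝ) • u (s + k (n + 1)) + u s‖
        ≤ (2 * k (n + 1))⁻¹ * (|C| * (k (n + 1) * √(k (n + 1)))) := by
          gcongr
          exact (h s _ hk1 hs.1 hsb).trans (by gcongr; exact le_abs_self C)
      _ = |C| * √(k (n + 1)) / 2 := by field_simp
      _ ≤ |C| * √(k n) := by
          have : √(k (n + 1)) ≤ √(k n) := Real.sqrt_le_sqrt (by rw [hks n]; linarith)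
          have h2 : |C| * √(k (n + 1)) ≤ |C| * √(k n) := by gcongr
          have h3 : 0 ≤ |C| * √(k (n + 1)) := by positivity
          linarith
      _ = (|C| * √η) * r ^ n := by rw [hkr]; ring
  have hlim : ∀ s ∈ Icc a b', ∃ v, Tendsto (fun n => q n s) atTop (𝓝 v) := fun s hs =>
    cauchySeq_tendsto_of_complete (cauchySeq_of_le_geometric r _ hr1 (hstep s hs))
  choose! v hv using hlim
  have hdist : ∀ s ∈ Icc a b', ∀ n, dist (q n s) (v s) ≤ |C| * √η * r ^ n / (1 - r) :=
    fun s hs n => dist_le_of_le_geometric_of_tendsto r _ hr1 (hstep s hs) (hv s hs) n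
  have hgeo : Tendsto (fun n : ℕ => |C| * √η * r ^ n / (1 - r)) atTop (𝓝 0) := by
    have := ((tendsto_pow_atTop_nhds_zero_of_lt_one (Real.sqrt_nonneg _) hr1).const_mul
      (|C| * √η)).div_const (1 - r)
    rwa [mul_zero, zero_div] at this
  have hunif : TendstoUniformlyOn q v atTop (Icc a b') := by
    rw [Metric.tendstoUniformlyOn_iff]
    intro ε hε
    filter_upwards [hgeo.eventually_lt_const hε] with n hn s hs
    rw [dist_comm]
    exact (hdist s hs n).trans_lt hn
  have hvc : ContinuousOn v (Icc a b') :=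
    hunif.continuousOn (Frequently.of_forall fun n => (hqc n).continuousOn)
  obtain ⟨W, hWc, hWv, -⟩ := hvc.exists_continuous_eqOn_Icc hab
  have hUd : ∀ s, HasDerivAt (fun x => ∫ t in a..x, U t) (U s) s := fun s =>
    intervalIntegral.integral_hasDerivAt_right (hUc.intervalIntegrable _ _)
      hUc.stronglyMeasurable.stronglyMeasurableAtFilter hUc.continuousAt
  have hk_lim : Tendsto k atTop (𝓝[≠] 0) := by
    refine tendsto_nhdsWithin_iff.2 ⟨?_, Eventually.of_forall fun n => (hk0 n).ne'⟩
    have := (tendsto_pow_atTop_nhds_zero_of_lt_one (by norm_num : (0 : ℝ) ≤ 1 / 2)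
      (by norm_num)).const_mul η
    rwa [mul_zero] at this
  have havg : ∀ s, Tendsto (fun n => (k n)⁻¹ • ∫ t in s..(s + k n), U t) atTop (𝓝 (U s)) := by
    intro s
    have := (hasDerivAt_iff_tendsto_slope_zero.1 (hUd s)).comp hk_lim
    refine this.congr fun n => ?_
    simp only [Function.comp_apply]
    rw [intervalIntegral.integral_interval_sub_left (hUc.intervalIntegrable _ _)
      (hUc.intervalIntegrable _ _)]
  -- The integral of `q n` over `[a, s]` is the mean of `U` over `[s, s + k n]` minus its mean over
  -- `[a, a + k n]`. Its limit shows that `u` is a primitive of the continuous limit of the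
  -- quotients.
  have hFTC : ∀ s ∈ Icc a b', ∫ t in a..s, W t = U s - U a := by
    intro s hs
    have h1 : Tendsto (fun n => ∫ t in a..s, q n t) atTop (𝓝 (∫ t in a..s, W t)) := by
      rw [tendsto_iff_norm_sub_tendsto_zero]
      refine squeeze_zero (fun _ => norm_nonneg _) (fun n => ?_)
        (by simpa using hgeo.mul_const |s - a|)
      rw [← intervalIntegral.integral_sub ((hqc n).intervalIntegrable _ _)
        (hWc.intervalIntegrable _ _)]
      refine intervalIntegral.norm_integral_le_of_norm_le_const fun t ht => ?_
      rw [uIoc_of_le hs.1] at ht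
      have ht' : t ∈ Icc a b' := ⟨ht.1.le, ht.2.trans hs.2⟩
      rw [hWv t ht', ← dist_eq_norm]
      exact hdist t ht' n
    refine tendsto_nhds_unique h1 (((havg s).sub (havg a)).congr fun n => ?_)
    simp only [hq]
    rw [intervalIntegral.integral_smul, intervalIntegral.integral_sub
      (Continuous.intervalIntegrable (by fun_prop) _ _) (hUc.intervalIntegrable _ _),
      intervalIntegral.integral_comp_add_right, ← smul_sub]
    congr 1
    have i1 : ∀ x y, IntervalIntegrable U volume x y := fun x y => hUc.intervalIntegrable x y
    have e1 := intervalIntegral.integral_add_adjacent_intervals (i1 a s) (i1 s (s + k n))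
    have e2 := intervalIntegral.integral_add_adjacent_intervals (i1 a (a + k n))
      (i1 (a + k n) (s + k n))
    rw [← e2] at e1
    rw [intervalIntegral.integral_interval_sub_interval_comm' (i1 _ _) (i1 _ _) (i1 _ _)]
  have hder : ∀ s ∈ Icc a b', HasDerivWithinAt u (v s) (Icc a b') s := by
    intro s hs
    have h1 : HasDerivAt (fun x => U a + ∫ t in a..x, W t) (W s) s :=
      (intervalIntegral.integral_hasDerivAt_right (hWc.intervalIntegrable _ _)
        hWc.stronglyMeasurable.stronglyMeasurableAtFilter hWc.continuousAt).const_add _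
    rw [hWv s hs] at h1
    refine h1.hasDerivWithinAt.congr (fun x hx => ?_) ?_
    · rw [hFTC x hx, hUu x ⟨hx.1, hx.2.trans hb.le⟩]; abel
    · rw [hFTC s hs, hUu s ⟨hs.1, hs.2.trans hb.le⟩]; abel
  have hud := uniqueDiffOn_Icc hab'
  rw [contDiffOn_one_iff_derivWithin hud]
  exact ⟨fun s hs => (hder s hs).differentiableWithinAt,
    hvc.congr fun s hs => (hder s hs).derivWithin (hud s hs)⟩

end Calculus


/-! ### Minimizing curves in a normed space are continuously differentiable -/

section MinimizingCurves

open MeasureTheory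

variable {E : Type*} [NormedAddCommGroup E] [NormedSpace ℝ E]

/-- `G` is a smooth Riemannian metric on the convex open subset `B` of a normed space, with
explicit ellipticity and distortion constants. -/
structure IsRiemannianOn (G : E → E →L[ℝ] E →L[ℝ] ℝ) (B : Set E) (κ K : ℝ) : Prop where
  isOpen : IsOpen B
  convex : Convex ℝ B
  contDiffOn : ContDiffOn ℝ ∞ G B
  symm : ∀ y ∈ B, ∀ v w, G y v w = G y w v
  ellipticity_pos : 0 < κ
  ellipticity : ∀ y ∈ B, ∀ v, κ * ‖v‖ ≤ √(G y v v)
  distortion_nonneg : 0 ≤ K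
  distortion : ∀ y ∈ B, ∀ z ∈ B, ∀ v, √(G y v v) ≤ (1 + K * ‖y - z‖) * √(G z v v)

/-- `u` is a curve in `B` which is parametrized by arclength and is not longer than any `C¹` curve
in `B` with the same end points; the chords of `u` are almost not longer than its arcs. -/
structure IsMinimizingOn (G : E → E →L[ℝ] E →L[ℝ] ℝ) (B : Set E) (K : ℝ) (u : ℝ → E)
    (a b : ℝ) : Prop where
  mapsTo : MapsTo u (Icc a b) B
  le_length : ∀ s ∈ Icc a b, ∀ s' ∈ Icc a b, s ≤ s' → ∀ (α β : ℝ) (w : ℝ → E), α ≤ β →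
    ContDiffOn ℝ 1 w (Icc α β) → MapsTo w (Icc α β) B → w α = u s → w β = u s' →
    s' - s ≤ ∫ t in α..β, √(G (w t) (derivWithin w (Icc α β) t) (derivWithin w (Icc α β) t))
  chord_le : ∀ s ∈ Icc a b, ∀ s' ∈ Icc a b, s ≤ s' → ∀ m ∈ B,
    √(G m (u s' - u s) (u s' - u s)) ≤ (1 + K * (‖m - u s‖ + (s' - s))) * (s' - s)

variable {G : E → E →L[ℝ] E →L[ℝ] ℝ} {B : Set E} {κ K : ℝ} {u : ℝ → E} {a b : ℝ}

/-- The square root of a negative number is `0` by convention, so ellipticity already forces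
positivity on nonzero vectors. -/
lemma IsRiemannianOn.nonneg (hG : IsRiemannianOn G B κ K) {y : E} (hy : y ∈ B) (v : E) :
    0 ≤ G y v v := by
  rcases eq_or_ne v 0 with rfl | hv
  · simp
  have h1 : 0 < √(G y v v) :=
    (mul_pos hG.ellipticity_pos (norm_pos_iff.2 hv)).trans_le (hG.ellipticity y hy v)
  exact (Real.sqrt_pos.1 h1).le

lemma IsMinimizingOn.norm_sub_le (hG : IsRiemannianOn G B κ K)
    (hu : IsMinimizingOn G B K u a b) {s s' : ℝ} (hs : s ∈ Icc a b) (hs' : s' ∈ Icc a b)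
    (hss : s ≤ s') : ‖u s' - u s‖ ≤ (1 + K * (b - a)) / κ * (s' - s) := by
  have h1 := hG.ellipticity _ (hu.mapsTo hs) (u s' - u s)
  have h2 := hu.chord_le s hs s' hs' hss _ (hu.mapsTo hs)
  rw [sub_self, norm_zero, zero_add] at h2
  rw [div_mul_eq_mul_div, le_div_iff₀ hG.ellipticity_pos, mul_comm]
  refine h1.trans (h2.trans ?_)
  have h3 : K * (s' - s) ≤ K * (b - a) :=
    mul_le_mul_of_nonneg_left (by linarith [hs.1, hs'.2]) hG.distortion_nonneg
  exact mul_le_mul_of_nonneg_right (by linarith) (by linarith)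

lemma IsMinimizingOn.continuousOn (hG : IsRiemannianOn G B κ K)
    (hu : IsMinimizingOn G B K u a b) : ContinuousOn u (Icc a b) := by
  refine LipschitzOnWith.continuousOn (K := Real.toNNReal ((1 + K * (b - a)) / κ))
    (LipschitzOnWith.of_dist_le_mul fun s hs s' hs' => ?_)
  have hab : a ≤ b := hs.1.trans hs.2
  have h0 : 0 ≤ (1 + K * (b - a)) / κ :=
    div_nonneg (by nlinarith [hG.distortion_nonneg]) hG.ellipticity_pos.le
  rw [Real.coe_toNNReal _ h0, Real.dist_eq]
  rcases le_total s s' with h | h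
  · rw [dist_comm, dist_eq_norm, abs_sub_comm, abs_of_nonneg (sub_nonneg.2 h)]
    exact hu.norm_sub_le hG hs hs' h
  · rw [dist_eq_norm, abs_of_nonneg (sub_nonneg.2 h)]
    exact hu.norm_sub_le hG hs' hs h

/-- The straight segment is not shorter than a minimizing curve. -/
lemma IsMinimizingOn.le_chord (hG : IsRiemannianOn G B κ K)
    (hu : IsMinimizingOn G B K u a b) {s s' : ℝ} (hs : s ∈ Icc a b) (hs' : s' ∈ Icc a b)
    (hss : s ≤ s') {m : E} (hm : m ∈ B) {r : ℝ} (h1 : ‖u s - m‖ ≤ r) (h2 : ‖u s' - m‖ ≤ r) :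
    s' - s ≤ (1 + K * r) * √(G m (u s' - u s) (u s' - u s)) := by
  set w : ℝ → E := fun t => u s + t • (u s' - u s) with hw
  have hwd : ∀ t, HasDerivAt w (u s' - u s) t := fun t => by
    rw [hw]
    simpa using ((hasDerivAt_id t).smul_const (u s' - u s)).const_add (u s)
  -- Convexity keeps the segment in `B` and within `r` of `m`, so that it is an admissible
  -- competitor whose speed is comparable with the one measured at `m`.
  have hwB : ∀ t ∈ Icc (0 : ℝ) 1, w t ∈ B ∩ Metric.closedBall m r := fun t ht =>
    (hG.convex.inter (convex_closedBall m r)).add_smul_sub_mem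
      ⟨hu.mapsTo hs, by simpa [dist_eq_norm] using h1⟩
      ⟨hu.mapsTo hs', by simpa [dist_eq_norm] using h2⟩ ht
  have hlen := hu.le_length s hs s' hs' hss 0 1 w zero_le_one
    (ContDiff.contDiffOn (by fun_prop)) (fun t ht => (hwB t ht).1) (by simp [hw]) (by simp [hw])
  refine hlen.trans ?_
  have hb : ∀ t ∈ uIoc (0 : ℝ) 1,
      ‖√(G (w t) (derivWithin w (Icc 0 1) t) (derivWithin w (Icc 0 1) t))‖ ≤
      (1 + K * r) * √(G m (u s' - u s) (u s' - u s)) := by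
    intro t ht
    rw [uIoc_of_le zero_le_one] at ht
    have ht' : t ∈ Icc (0 : ℝ) 1 := ⟨ht.1.le, ht.2⟩
    rw [(hwd t).hasDerivWithinAt.derivWithin (uniqueDiffOn_Icc zero_lt_one t ht'),
      Real.norm_of_nonneg (Real.sqrt_nonneg _)]
    refine (hG.distortion _ (hwB t ht').1 m hm _).trans ?_
    have h3 : ‖w t - m‖ ≤ r := by simpa [dist_eq_norm] using (hwB t ht').2
    have := mul_le_mul_of_nonneg_left h3 hG.distortion_nonneg
    exact mul_le_mul_of_nonneg_right (by linarith) (Real.sqrt_nonneg _)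
  have := intervalIntegral.norm_integral_le_of_norm_le_const hb
  simpa using (Real.le_norm_self _).trans this

/-- Let `x`, `m`, `y` be the points at `s`, `s + k`, `s + 2k`. Measured by `G m`, both half chords
have length at most `(1 + δ)k` and, by minimality, the full chord has length at least `2k / (1 +
δ)`, with `δ = O(k)`. The parallelogram identity then leaves only `O(k³)` for the square of `y - 2m
+ x`. -/
lemma IsMinimizingOn.exists_second_difference_le (hG : IsRiemannianOn G B κ K)
    (hu : IsMinimizingOn G B K u a b) (hab : a ≤ b) :
    ∃ C, ∀ s k, 0 < k → a ≤ s → s + 2 * k ≤ b →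
      ‖u (s + 2 * k) - (2 : ℝ) • u (s + k) + u s‖ ≤ C * (k * √k) := by
  have hκ := hG.ellipticity_pos
  have hK := hG.distortion_nonneg
  set Λ := (1 + K * (b - a)) / κ with hΛ
  have hΛ0 : 0 ≤ Λ := div_nonneg (by nlinarith) hκ.le
  -- `K1` absorbs both the passage of time and the Lipschitz constant `Λ` of `u`, so that one error
  -- `δ = K1 * k ≤ D` serves all three chords.
  set K1 := K * (Λ + 1) with hK1
  have hK10 : 0 ≤ K1 := by positivity
  set D := K1 * (b - a) with hD
  have hD0 : 0 ≤ D := mul_nonneg hK10 (by linarith)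
  refine ⟨√(4 * K1 * (4 + D)) / κ, fun s k hk hs hsb => ?_⟩
  have hx : s ∈ Icc a b := ⟨hs, by linarith⟩
  have hm : s + k ∈ Icc a b := ⟨by linarith, by linarith⟩
  have hy : s + 2 * k ∈ Icc a b := ⟨by linarith, hsb⟩
  have hmB := hu.mapsTo hm
  set x := u s
  set m := u (s + k)
  set y := u (s + 2 * k)
  have nxm : ‖m - x‖ ≤ Λ * k := by
    have := hu.norm_sub_le hG hx hm (by linarith)
    simpa using this
  have nym : ‖y - m‖ ≤ Λ * k := by
    have := hu.norm_sub_le hG hm hy (by linarith)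
    rwa [show s + 2 * k - (s + k) = k by ring] at this
  set δ := K1 * k with hδ
  have hδ0 : 0 ≤ δ := by positivity
  have hδD : δ ≤ D := mul_le_mul_of_nonneg_left (by linarith) hK10
  have hA : √(G m (y - m) (y - m)) ≤ (1 + δ) * k := by
    have := hu.chord_le _ hm _ hy (by linarith) m hmB
    rw [sub_self, norm_zero, show s + 2 * k - (s + k) = k by ring] at this
    refine this.trans (mul_le_mul_of_nonneg_right ?_ hk.le)
    have : 0 ≤ K * Λ * k := by positivity
    rw [hδ, hK1]; nlinarith
  have hB : √(G m (m - x) (m - x)) ≤ (1 + δ) * k := by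
    have := hu.chord_le _ hx _ hm (by linarith) m hmB
    rw [show s + k - s = k by ring] at this
    refine this.trans (mul_le_mul_of_nonneg_right ?_ hk.le)
    have := mul_le_mul_of_nonneg_left nxm hK
    rw [hδ, hK1]; linarith
  have hS : 2 * k ≤ (1 + δ) * √(G m (y - x) (y - x)) := by
    have := hu.le_chord hG hx hy (by linarith) hmB (r := Λ * k) (by rwa [norm_sub_rev]) nym
    rw [show s + 2 * k - s = 2 * k by ring] at this
    refine this.trans (mul_le_mul_of_nonneg_right ?_ (Real.sqrt_nonneg _))
    have : 0 ≤ K * k := by positivity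
    rw [hδ, hK1]; linarith
  -- parallelogram identity for `G m`
  have hpar : G m (y - (2 : ℝ) • m + x) (y - (2 : ℝ) • m + x) =
      2 * G m (y - m) (y - m) + 2 * G m (m - x) (m - x) - G m (y - x) (y - x) := by
    rw [show y - (2 : ℝ) • m + x = (y - m) - (m - x) by module,
      show y - x = (y - m) + (m - x) by abel]
    simp only [map_sub, map_add, _root_.sub_apply, _root_.add_apply]
    ring
  have sqA : G m (y - m) (y - m) ≤ ((1 + δ) * k) ^ 2 := by
    rw [← Real.sq_sqrt (hG.nonneg hmB (y - m))]
    exact pow_le_pow_left₀ (Real.sqrt_nonneg _) hA 2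
  have sqB : G m (m - x) (m - x) ≤ ((1 + δ) * k) ^ 2 := by
    rw [← Real.sq_sqrt (hG.nonneg hmB (m - x))]
    exact pow_le_pow_left₀ (Real.sqrt_nonneg _) hB 2
  -- Uses `(1 + δ)² (1 - 2δ) = 1 - 3δ² - 2δ³ ≤ 1`; if `1 - 2δ ≤ 0` the bound is trivial.
  have sqS : (2 * k) ^ 2 * (1 - 2 * δ) ≤ G m (y - x) (y - x) := by
    have h1 : (2 * k) ^ 2 ≤ (1 + δ) ^ 2 * G m (y - x) (y - x) := by
      have := pow_le_pow_left₀ (by positivity) hS 2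
      rwa [mul_pow (1 + δ), Real.sq_sqrt (hG.nonneg hmB _)] at this
    have h2 := hG.nonneg hmB (y - x)
    rcases le_or_gt (1 - 2 * δ) 0 with h | h
    · exact (mul_nonpos_of_nonneg_of_nonpos (by positivity) h).trans h2
    · calc (2 * k) ^ 2 * (1 - 2 * δ) ≤ ((1 + δ) ^ 2 * G m (y - x) (y - x)) * (1 - 2 * δ) := by
            gcongr
        _ = ((1 + δ) ^ 2 * (1 - 2 * δ)) * G m (y - x) (y - x) := by ring
        _ ≤ 1 * G m (y - x) (y - x) := by
          gcongr
          nlinarith [mul_nonneg hδ0 (sq_nonneg δ), sq_nonneg δ]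
        _ = _ := one_mul _
  have hfin : G m (y - (2 : ℝ) • m + x) (y - (2 : ℝ) • m + x) ≤ 4 * K1 * (4 + D) * k ^ 3 := by
    rw [hpar]
    have h1 : 2 * ((1 + δ) * k) ^ 2 + 2 * ((1 + δ) * k) ^ 2 - (2 * k) ^ 2 * (1 - 2 * δ) =
        4 * k ^ 2 * (δ * (4 + δ)) := by ring
    have h2 : 4 * k ^ 2 * (δ * (4 + δ)) ≤ 4 * k ^ 2 * (δ * (4 + D)) := by gcongr
    have h3 : 4 * k ^ 2 * (δ * (4 + D)) = 4 * K1 * (4 + D) * k ^ 3 := by rw [hδ]; ring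
    linarith
  have hell := hG.ellipticity m hmB (y - (2 : ℝ) • m + x)
  have h4 : √(G m (y - (2 : ℝ) • m + x) (y - (2 : ℝ) • m + x)) ≤
      √(4 * K1 * (4 + D)) * (k * √k) := by
    refine (Real.sqrt_le_sqrt hfin).trans (le_of_eq ?_)
    rw [Real.sqrt_mul (by positivity), show k ^ 3 = k ^ 2 * k by ring,
      Real.sqrt_mul (sq_nonneg k), Real.sqrt_sq hk.le]
  rw [div_mul_eq_mul_div, le_div_iff₀ hκ, mul_comm]
  exact hell.trans h4

lemma IsMinimizingOn.contDiffOn_one [CompleteSpace E] (hG : IsRiemannianOn G B κ K)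
    (hu : IsMinimizingOn G B K u a b) {β : ℝ} (ha : a ≤ β) (hb : β < b) :
    ContDiffOn ℝ 1 u (Icc a β) := by
  obtain ⟨C, hC⟩ := hu.exists_second_difference_le hG (ha.trans hb.le)
  exact contDiffOn_one_of_second_difference_le ha hb (hu.continuousOn hG) hC

lemma IsMinimizingOn.mono (hu : IsMinimizingOn G B K u a b) {α β : ℝ} (h : Icc α β ⊆ Icc a b) :
    IsMinimizingOn G B K u α β where
  mapsTo := hu.mapsTo.mono_left h
  le_length s hs s' hs' := hu.le_length s (h hs) s' (h hs')
  chord_le s hs s' hs' := hu.chord_le s (h hs) s' (h hs')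

/-- The chord estimate at `m = u s`, divided by the elapsed parameter, tends to a bound by `1` for
the speed. -/
lemma IsMinimizingOn.speed_le (hu : IsMinimizingOn G B K u a b) (hab : a < b)
    (hd : DifferentiableOn ℝ u (Icc a b)) {s : ℝ} (hs : s ∈ Icc a b) :
    G (u s) (derivWithin u (Icc a b) s) (derivWithin u (Icc a b) s) ≤ 1 := by
  set v := derivWithin u (Icc a b) s
  have hv : HasDerivWithinAt u v (Icc a b) s := (hd s hs).hasDerivWithinAt
  have hne : (𝓝[Icc a b \ {s}] s).NeBot :=
    accPt_principal_iff_nhdsWithin.1 ((uniqueDiffOn_Icc hab s hs).accPt)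
  have hslope := hasDerivWithinAt_iff_tendsto_slope.1 hv
  have hcont : Continuous fun z : E => √(G (u s) z z) := by fun_prop
  have h1 := (hcont.tendsto v).comp hslope
  -- The absolute value appears because `IsMinimizingOn` alone does not make `K` nonnegative.
  have h2 : Tendsto (fun s' => 1 + |K| * (‖u s - u s'‖ + |s' - s|)) (𝓝[Icc a b \ {s}] s)
      (𝓝 (1 + |K| * (‖u s - u s‖ + |s - s|))) := by
    have hc : Tendsto u (𝓝[Icc a b \ {s}] s) (𝓝 (u s)) :=
      (hv.continuousWithinAt).mono_left (nhdsWithin_mono _ sdiff_subset)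
    have hi : Tendsto (fun s' : ℝ => s') (𝓝[Icc a b \ {s}] s) (𝓝 s) :=
      tendsto_id.mono_left nhdsWithin_le_nhds
    exact (((tendsto_const_nhds.sub hc).norm.add ((hi.sub_const s).abs)).const_mul _).const_add _
  rw [sub_self, norm_zero, sub_self, abs_zero, add_zero, mul_zero, add_zero] at h2
  have h3 : √(G (u s) v v) ≤ 1 := by
    refine le_of_tendsto_of_tendsto h1 h2 ?_
    filter_upwards [self_mem_nhdsWithin] with s' hs'
    have hne' : s' - s ≠ 0 := sub_ne_zero.2 hs'.2
    simp only [Function.comp_apply, slope_def_module, map_smul, _root_.smul_apply, smul_eq_mul]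
    rw [← mul_assoc, ← sq, Real.sqrt_mul (sq_nonneg _), Real.sqrt_sq_eq_abs, abs_inv,
      inv_mul_le_iff₀ (abs_pos.2 hne')]
    rcases le_total s s' with h | h
    · have := hu.chord_le s hs s' hs'.1 h (u s) (hu.mapsTo hs)
      rw [sub_self, norm_zero, zero_add] at this
      rw [abs_of_nonneg (sub_nonneg.2 h), mul_comm]
      refine this.trans (mul_le_mul_of_nonneg_right ?_ (sub_nonneg.2 h))
      have h5 : K * (s' - s) ≤ |K| * (s' - s) :=
        mul_le_mul_of_nonneg_right (le_abs_self K) (sub_nonneg.2 h)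
      have h6 : 0 ≤ |K| * ‖u s - u s'‖ := by positivity
      linarith
    · have := hu.chord_le s' hs'.1 s hs h (u s) (hu.mapsTo hs)
      have hneg : G (u s) (u s - u s') (u s - u s') = G (u s) (u s' - u s) (u s' - u s) := by
        rw [← neg_sub (u s') (u s), map_neg, map_neg, _root_.neg_apply, neg_neg]
      rw [hneg] at this
      rw [abs_of_nonpos (sub_nonpos.2 h), mul_comm, neg_sub]
      refine this.trans (mul_le_mul_of_nonneg_right ?_ (sub_nonneg.2 h))
      have h0 : 0 ≤ ‖u s - u s'‖ + (s - s') := add_nonneg (norm_nonneg _) (sub_nonneg.2 h)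
      have := mul_le_mul_of_nonneg_right (le_abs_self K) h0
      linarith
  rwa [Real.sqrt_le_one] at h3

end MinimizingCurves


/-! ### First variation, the geodesic equation and smoothness -/

section EulerLagrange

set_option maxSynthPendingDepth 3

open MeasureTheory

variable {E : Type*} [NormedAddCommGroup E] [NormedSpace ℝ E]
  {G : E → E →L[ℝ] E →L[ℝ] ℝ} {B : Set E} {κ K : ℝ} {u : ℝ → E} {a b : ℝ}

/-- Small smooth perturbations of a compact curve in `B` remain in `B`. -/
lemma exists_forall_add_smul_mem {U : ℝ → E} {f : ℝ → ℝ} (hB : IsOpen B) (hU : Continuous U)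
    (hUB : ∀ t, U t ∈ B) (hf : Continuous f) (w : E) (a b : ℝ) :
    ∃ δ, 0 < δ ∧ ∀ ε ∈ Icc (-δ) δ, ∀ t ∈ Icc a b, U t + (ε * f t) • w ∈ B := by
  have hcpt : IsCompact (U '' Icc a b) := isCompact_Icc.image hU
  obtain ⟨ρ, hρ, hsub⟩ := hcpt.exists_cthickening_subset_open hB
    (by rintro _ ⟨t, -, rfl⟩; exact hUB t)
  obtain ⟨C, hC⟩ := isCompact_Icc.exists_bound_of_continuousOn (s := Icc a b) hf.continuousOn
  have hden : 0 < |C| * ‖w‖ + 1 := by positivity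
  refine ⟨ρ / (|C| * ‖w‖ + 1), by positivity, fun ε hε t ht => hsub ?_⟩
  refine Metric.mem_cthickening_of_dist_le _ (U t) _ _ (mem_image_of_mem U ht) ?_
  rw [dist_eq_norm, add_sub_cancel_left, norm_smul, norm_mul, Real.norm_eq_abs]
  have h1 : |ε| ≤ ρ / (|C| * ‖w‖ + 1) := abs_le.2 hε
  calc |ε| * ‖f t‖ * ‖w‖ ≤ ρ / (|C| * ‖w‖ + 1) * |C| * ‖w‖ := by
        gcongr
        exact (hC t ht).trans (le_abs_self C)
    _ = ρ * ((|C| * ‖w‖) / (|C| * ‖w‖ + 1)) := by ring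
    _ ≤ ρ * 1 := by
        gcongr
        rw [div_le_one hden]; linarith
    _ = ρ := mul_one ρ

lemma HasDerivAt.clm_apply_self {c : ℝ → E →L[ℝ] E →L[ℝ] ℝ} {c' : E →L[ℝ] E →L[ℝ] ℝ}
    {z : ℝ → E} {z' : E} {x : ℝ} (hc : HasDerivAt c c' x) (hz : HasDerivAt z z' x) :
    HasDerivAt (fun y => c y (z y) (z y)) (c' (z x) (z x) + c x z' (z x) + c x (z x) z') x := by
  have h1 : HasDerivAt (fun y => c y (z y)) (c' (z x) + c x z') x := hc.clm_apply hz
  have h2 : HasDerivAt (fun y => c y (z y) (z y)) ((c' (z x) + c x z') (z x) + c x (z x) z') x :=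
    h1.clm_apply hz
  rwa [_root_.add_apply] at h2

/-- The first variation of the energy of a minimizing curve vanishes. -/
lemma IsMinimizingOn.first_variation (hG : IsRiemannianOn G B κ K)
    (hu : IsMinimizingOn G B K u a b) (hab : a < b) (hd : ContDiffOn ℝ 1 u (Icc a b))
    {U V : ℝ → E} (hU : Continuous U) (hUu : ∀ s ∈ Icc a b, U s = u s) (hUB : ∀ s, U s ∈ B)
    (hV : Continuous V) (hVv : ∀ s ∈ Icc a b, V s = derivWithin u (Icc a b) s)
    (w : E) {f f' : ℝ → ℝ} (hf : ∀ t, HasDerivAt f (f' t) t) (hf' : Continuous f')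
    (hfa : f a = 0) (hfb : f b = 0) :
    ∫ t in a..b, (fderiv ℝ G (U t) w (V t) (V t) * f t + 2 * G (U t) (V t) w * f' t) = 0 := by
  have hfc : Continuous f := continuous_iff_continuousAt.2 fun t => (hf t).continuousAt
  obtain ⟨δ, hδ, hδB⟩ := exists_forall_add_smul_mem hG.isOpen hU hUB hfc w a b
  have hud := uniqueDiffOn_Icc hab
  have hGc : ContinuousOn G B := hG.contDiffOn.continuousOn
  have hG'c : ContinuousOn (fderiv ℝ G) B :=
    hG.contDiffOn.continuousOn_fderiv_of_isOpen hG.isOpen (by simp)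
  set y : ℝ → ℝ → E := fun ε t => U t + (ε * f t) • w with hy
  set z : ℝ → ℝ → E := fun ε t => V t + (ε * f' t) • w with hz
  set F : ℝ → ℝ → ℝ := fun ε t => G (y ε t) (z ε t) (z ε t) with hF
  set F' : ℝ → ℝ → ℝ := fun ε t => fderiv ℝ G (y ε t) (f t • w) (z ε t) (z ε t) +
    G (y ε t) (f' t • w) (z ε t) + G (y ε t) (z ε t) (f' t • w) with hF'
  have hyc : Continuous (Function.uncurry y) := by
    simp only [hy, Function.uncurry_def]; fun_prop
  have hzc : Continuous (Function.uncurry z) := by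
    simp only [hz, Function.uncurry_def]; fun_prop
  have hyB : MapsTo (Function.uncurry y) (Icc (-δ) δ ×ˢ Icc a b) B := fun x hx =>
    hδB x.1 hx.1 x.2 hx.2
  have hGy : ContinuousOn (fun x : ℝ × ℝ => G (y x.1 x.2)) (Icc (-δ) δ ×ˢ Icc a b) :=
    hGc.comp hyc.continuousOn hyB
  have hG'y : ContinuousOn (fun x : ℝ × ℝ => fderiv ℝ G (y x.1 x.2)) (Icc (-δ) δ ×ˢ Icc a b) :=
    hG'c.comp hyc.continuousOn hyB
  have hzc' : ContinuousOn (fun x : ℝ × ℝ => z x.1 x.2) (Icc (-δ) δ ×ˢ Icc a b) :=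
    hzc.continuousOn
  have hfw : ContinuousOn (fun x : ℝ × ℝ => f x.2 • w) (Icc (-δ) δ ×ˢ Icc a b) :=
    Continuous.continuousOn (by fun_prop)
  have hfw' : ContinuousOn (fun x : ℝ × ℝ => f' x.2 • w) (Icc (-δ) δ ×ˢ Icc a b) :=
    Continuous.continuousOn (by fun_prop)
  have hFc : ContinuousOn (Function.uncurry F) (Icc (-δ) δ ×ˢ Icc a b) :=
    (hGy.clm_apply hzc').clm_apply hzc'
  have hF'c : ContinuousOn (Function.uncurry F') (Icc (-δ) δ ×ˢ Icc a b) :=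
    ((((hG'y.clm_apply hfw).clm_apply hzc').clm_apply hzc').add
      ((hGy.clm_apply hfw').clm_apply hzc')).add ((hGy.clm_apply hzc').clm_apply hfw')
  have hderiv : ∀ t ∈ Icc a b, ∀ ε ∈ Ioo (-δ) δ, HasDerivAt (fun x => F x t) (F' ε t) ε := by
    intro t ht ε hε
    have h1 : HasDerivAt (fun x => y x t) (f t • w) ε := by
      have := (((hasDerivAt_id ε).mul_const (f t)).smul_const w).const_add (U t)
      simpa [hy] using this
    have h2 : HasDerivAt (fun x => z x t) (f' t • w) ε := by
      have := (((hasDerivAt_id ε).mul_const (f' t)).smul_const w).const_add (V t)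
      simpa [hz] using this
    have hyt : y ε t ∈ B := hδB ε (Ioo_subset_Icc_self hε) t ht
    have h3 : HasFDerivAt G (fderiv ℝ G (y ε t)) (y ε t) :=
      ((hG.contDiffOn.differentiableOn (by simp)).differentiableAt
        (hG.isOpen.mem_nhds hyt)).hasFDerivAt
    have h4 : HasDerivAt (fun x => G (y x t)) (fderiv ℝ G (y ε t) (f t • w)) ε :=
      h3.comp_hasDerivAt ε h1
    exact h4.clm_apply_self h2
  have hmain := hasDerivAt_intervalIntegral_of_continuousOn hab.le hδ hFc hF'c hderiv
  have hFint : ∀ ε ∈ Icc (-δ) δ, ContinuousOn (F ε) (Icc a b) := fun ε hε =>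
    hFc.comp (f := fun t => (ε, t)) (by fun_prop) fun t ht => ⟨hε, ht⟩
  -- the energy is minimal for `ε = 0`
  have hlow : ∀ ε ∈ Icc (-δ) δ, b - a ≤ ∫ t in a..b, F ε t := by
    intro ε hε
    have hyd : ∀ t ∈ Icc a b, HasDerivWithinAt (fun t => u t + (ε * f t) • w) (z ε t)
        (Icc a b) t := fun t ht => by
      have h1 : HasDerivWithinAt u (V t) (Icc a b) t := by
        rw [hVv t ht]
        exact (hd.differentiableOn one_ne_zero t ht).hasDerivWithinAt
      exact h1.add (((hf t).hasDerivWithinAt.const_mul ε).smul_const w)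
    have hfC : ContDiff ℝ 1 f := by
      rw [contDiff_one_iff_deriv]
      exact ⟨fun t => (hf t).differentiableAt, by
        rwa [show deriv f = f' from funext fun t => (hf t).deriv]⟩
    have hyC : ContDiffOn ℝ 1 (fun t => u t + (ε * f t) • w) (Icc a b) :=
      hd.add (ContDiff.contDiffOn (by fun_prop))
    have hlen := hu.le_length a (left_mem_Icc.2 hab.le) b (right_mem_Icc.2 hab.le) hab.le a b
      (fun t => u t + (ε * f t) • w) hab.le hyC
      (fun t ht => by simpa only [← hUu t ht] using hδB ε hε t ht)
      (by simp [hfa]) (by simp [hfb])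
    have hcong : ∫ t in a..b, √(G (u t + (ε * f t) • w)
        (derivWithin (fun t => u t + (ε * f t) • w) (Icc a b) t)
        (derivWithin (fun t => u t + (ε * f t) • w) (Icc a b) t)) = ∫ t in a..b, √(F ε t) := by
      refine intervalIntegral.integral_congr fun t ht => ?_
      rw [uIcc_of_le hab.le] at ht
      simp only [hF, hy]
      rw [(hyd t ht).derivWithin (hud t ht), hUu t ht]
    rw [hcong] at hlen
    have hFi : IntervalIntegrable (F ε) volume a b :=
      (hFint ε hε).intervalIntegrable_of_Icc hab.le
    have hsi : IntervalIntegrable (fun t => √(F ε t)) volume a b :=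
      ((hFint ε hε).sqrt).intervalIntegrable_of_Icc hab.le
    -- The inequality `2√F ≤ 1 + F` turns the lower bound on length into the lower bound `b - a` on
    -- energy, which is differentiable in `ε` even where the speed vanishes. The bound is attained
    -- at `ε = 0` since the speed of `u` is at most `1`.
    have hle : ∫ t in a..b, √(F ε t) ≤ ∫ t in a..b, ((1 : ℝ) + F ε t) / 2 := by
      refine intervalIntegral.integral_mono_on hab.le hsi
        ((intervalIntegrable_const.add hFi).div_const 2) fun t ht => ?_
      have h0 : 0 ≤ F ε t := hG.nonneg (hδB ε hε t ht) _
      have := sq_nonneg (√(F ε t) - 1)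
      have h2 := Real.sq_sqrt h0
      nlinarith
    rw [intervalIntegral.integral_div, intervalIntegral.integral_add intervalIntegrable_const hFi,
      intervalIntegral.integral_const, smul_eq_mul, mul_one] at hle
    linarith
  have hupp : ∫ t in a..b, F 0 t ≤ b - a := by
    have h0 : (0 : ℝ) ∈ Icc (-δ) δ := ⟨by linarith, hδ.le⟩
    have : ∫ t in a..b, F 0 t ≤ ∫ _t in a..b, (1 : ℝ) := by
      refine intervalIntegral.integral_mono_on hab.le
        ((hFint 0 h0).intervalIntegrable_of_Icc hab.le) intervalIntegrable_const fun t ht => ?_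
      simp only [hF, hy, hz, zero_mul, zero_smul, add_zero]
      rw [hUu t ht, hVv t ht]
      exact hu.speed_le hab (hd.differentiableOn one_ne_zero) ht
    simpa using this
  have hmin : IsLocalMin (fun ε => ∫ t in a..b, F ε t) 0 := by
    filter_upwards [Icc_mem_nhds (by linarith : -δ < 0) hδ] with ε hε
    exact hupp.trans (hlow ε hε)
  have h0 := hmin.hasDerivAt_eq_zero hmain
  rw [← h0]
  refine intervalIntegral.integral_congr fun t ht => ?_
  rw [uIcc_of_le hab.le] at ht
  simp only [hF', hy, hz, zero_mul, zero_smul, add_zero, map_smul, _root_.smul_apply, smul_eq_mul]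
  rw [hG.symm _ (hUB t) w (V t)]
  ring

/-- The geodesic equation, in terms of the momentum `G (u, u')`. -/
lemma IsMinimizingOn.hasDerivWithinAt_momentum (hG : IsRiemannianOn G B κ K)
    (hu : IsMinimizingOn G B K u a b) (hab : a < b) (hd : ContDiffOn ℝ 1 u (Icc a b))
    (w : E) {t : ℝ} (ht : t ∈ Icc a b) :
    HasDerivWithinAt (fun t => G (u t) (derivWithin u (Icc a b) t) w)
      (2⁻¹ * fderiv ℝ G (u t) w (derivWithin u (Icc a b) t) (derivWithin u (Icc a b) t))
      (Icc a b) t := by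
  obtain ⟨U, hU, hUu, hUi⟩ := hd.continuousOn.exists_continuous_eqOn_Icc hab.le
  obtain ⟨V, hV, hVv, -⟩ := (((contDiffOn_one_iff_derivWithin
    (uniqueDiffOn_Icc hab)).1 hd).2).exists_continuous_eqOn_Icc hab.le
  have hUB : ∀ s, U s ∈ B := fun s => by
    obtain ⟨x, hx, hxs⟩ := hUi s
    exact hxs ▸ hu.mapsTo hx
  have hGU : Continuous fun t => G (U t) := hG.contDiffOn.continuousOn.comp_continuous hU hUB
  have hG'U : Continuous fun t => fderiv ℝ G (U t) :=
    (hG.contDiffOn.continuousOn_fderiv_of_isOpen hG.isOpen (by simp)).comp_continuous hU hUB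
  have hQ : Continuous fun t => fderiv ℝ G (U t) w (V t) (V t) := by fun_prop
  -- The vanishing first variation in the fixed direction `w` is exactly the hypothesis of du
  -- Bois-Reymond's lemma. It makes the momentum differentiable although `u` is only known to be
  -- `C¹`.
  obtain ⟨c, hc⟩ := eq_const_add_integral_of_forall_integral_eq_zero
    (P := fun t => 2 * G (U t) (V t) w) (Q := fun t => fderiv ℝ G (U t) w (V t) (V t)) hab
    (((hGU.clm_apply hV).clm_apply continuous_const).const_mul 2) hQ fun f f' hf hf' hfa hfb =>
      hu.first_variation hG hab hd hU hUu hUB hV hVv w hf hf' hfa hfb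
  have h1 : HasDerivAt (fun t => 2⁻¹ * (c + ∫ x in a..t, fderiv ℝ G (U x) w (V x) (V x)))
      (2⁻¹ * fderiv ℝ G (U t) w (V t) (V t)) t :=
    ((intervalIntegral.integral_hasDerivAt_right (hQ.intervalIntegrable _ _)
      hQ.stronglyMeasurable.stronglyMeasurableAtFilter hQ.continuousAt).const_add c).const_mul _
  rw [← hUu t ht, ← hVv t ht]
  have h2 : ∀ s ∈ Icc a b, G (u s) (derivWithin u (Icc a b) s) w =
      2⁻¹ * (c + ∫ x in a..s, fderiv ℝ G (U x) w (V x) (V x)) := fun s hs => by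
    have := hc s hs
    rw [← this, hUu s hs, hVv s hs]
    ring
  exact h1.hasDerivWithinAt.congr h2 (h2 t ht)

variable [FiniteDimensional ℝ E]

/-- Definiteness makes `G y` injective, and the dual has the same finite dimension. This allows the
velocity to be recovered from the momentum. -/
lemma IsRiemannianOn.exists_equiv (hG : IsRiemannianOn G B κ K) {y : E} (hy : y ∈ B) :
    ∃ e : E ≃L[ℝ] (E →L[ℝ] ℝ), (e : E →L[ℝ] (E →L[ℝ] ℝ)) = G y := by
  have hfin : Module.finrank ℝ E = Module.finrank ℝ (E →L[ℝ] ℝ) := by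
    rw [← LinearEquiv.finrank_eq (LinearMap.toContinuousLinearMap (𝕜 := ℝ) (E := E) (F' := ℝ))]
    exact (Subspace.dual_finrank_eq).symm
  have hinj : Function.Injective (G y : E →ₗ[ℝ] (E →L[ℝ] ℝ)) := by
    rw [← LinearMap.ker_eq_bot, LinearMap.ker_eq_bot']
    intro v hv
    by_contra hne
    have h1 : 0 < √(G y v v) :=
      (mul_pos hG.ellipticity_pos (norm_pos_iff.2 hne)).trans_le (hG.ellipticity y hy v)
    have h2 : G y v = 0 := hv
    simp [h2] at h1
  refine ⟨(LinearMap.linearEquivOfInjective _ hinj hfin).toContinuousLinearEquiv, ?_⟩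
  ext v w
  simp

/-- Minimizing curves are smooth. -/
theorem IsMinimizingOn.contDiffOn (hG : IsRiemannianOn G B κ K)
    (hu : IsMinimizingOn G B K u a b) {β : ℝ} (ha : a < β) (hb : β < b) :
    ContDiffOn ℝ ∞ u (Icc a β) := by
  have hd : ContDiffOn ℝ 1 u (Icc a β) := hu.contDiffOn_one hG ha.le hb
  replace hu : IsMinimizingOn G B K u a β := hu.mono (Icc_subset_Icc_right hb.le)
  have hud := uniqueDiffOn_Icc ha
  set v := derivWithin u (Icc a β) with hv
  -- Bootstrapping: if the velocity is `Cⁿ`, the geodesic equation gives the momentum a `Cⁿ`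
  -- derivative. The momentum is then `Cⁿ⁺¹`, and applying the inverse of `G (u t)`, which is `Cⁿ⁺¹`
  -- in `t`, yields a `Cⁿ⁺¹` velocity.
  have hstep : ∀ n : ℕ, ContDiffOn ℝ n v (Icc a β) := by
    intro n
    induction n with
    | zero =>
      rw [Nat.cast_zero, contDiffOn_zero]
      exact ((contDiffOn_one_iff_derivWithin hud).1 hd).2
    | succ n ih =>
      have hu' : ContDiffOn ℝ (n + 1) u (Icc a β) := by
        rw [contDiffOn_succ_iff_derivWithin hud]
        exact ⟨hd.differentiableOn one_ne_zero, by simp, ih⟩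
      have hun : ContDiffOn ℝ n u (Icc a β) := hu'.of_le (by exact_mod_cast Nat.le_succ n)
      have hG' : ContDiffOn ℝ n (fderiv ℝ G) B :=
        hG.contDiffOn.fderiv_of_isOpen hG.isOpen (by exact_mod_cast le_top)
      have hp : ContDiffOn ℝ (n + 1) (fun t => G (u t) (v t)) (Icc a β) := by
        rw [contDiffOn_clm_apply]
        intro w
        have hw := fun t (ht : t ∈ Icc a β) => hu.hasDerivWithinAt_momentum hG ha hd w ht
        rw [contDiffOn_succ_iff_derivWithin hud]
        refine ⟨fun t ht => (hw t ht).differentiableWithinAt, by simp, ?_⟩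
        refine ContDiffOn.congr ?_ fun t ht => (hw t ht).derivWithin (hud t ht)
        exact contDiffOn_const.mul ((((hG'.comp hun hu.mapsTo).clm_apply
          contDiffOn_const).clm_apply ih).clm_apply ih)
      have hinv : ContDiffOn ℝ (n + 1) (fun t => ContinuousLinearMap.inverse (G (u t)))
          (Icc a β) := by
        intro t ht
        obtain ⟨e, he⟩ := hG.exists_equiv (hu.mapsTo ht)
        have h1 : ContDiffAt ℝ (n + 1) ContinuousLinearMap.inverse (G (u t)) :=
          he ▸ contDiffAt_map_inverse e
        have h2 : ContDiffOn ℝ (n + 1) (fun t => G (u t)) (Icc a β) :=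
          (hG.contDiffOn.of_le (by exact_mod_cast le_top)).comp hu' hu.mapsTo
        exact h1.comp_contDiffWithinAt t (h2 t ht)
      have := hinv.clm_apply hp
      rw [Nat.cast_succ]
      refine this.congr fun t ht => ?_
      obtain ⟨e, he⟩ := hG.exists_equiv (hu.mapsTo ht)
      rw [← he, ContinuousLinearMap.inverse_equiv]
      simp
  rw [contDiffOn_infty]
  intro n
  refine ContDiffOn.of_le (n := (n : WithTop ℕ∞) + 1) ?_ (by exact_mod_cast Nat.le_succ n)
  rw [contDiffOn_succ_iff_derivWithin hud]
  exact ⟨hd.differentiableOn one_ne_zero, by simp, hstep n⟩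

end EulerLagrange


/-! ### Local estimates for a smooth Riemannian metric -/

section LocalMetric

set_option maxSynthPendingDepth 3

open MeasureTheory

variable {E : Type*} [NormedAddCommGroup E] [NormedSpace ℝ E]
  {G : E → E →L[ℝ] E →L[ℝ] ℝ} {B : Set E} {κ K : ℝ}

lemma IsRiemannianOn.mono_distortion (hG : IsRiemannianOn G B κ K) {K' : ℝ} (h : K ≤ K') :
    IsRiemannianOn G B κ K' where
  isOpen := hG.isOpen
  convex := hG.convex
  contDiffOn := hG.contDiffOn
  symm := hG.symm
  ellipticity_pos := hG.ellipticity_pos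
  ellipticity := hG.ellipticity
  distortion_nonneg := hG.distortion_nonneg.trans h
  distortion y hy z hz v := (hG.distortion y hy z hz v).trans (by gcongr)

lemma IsRiemannianOn.apply_le_sqrt_mul_sqrt (hG : IsRiemannianOn G B κ K) {m : E} (hm : m ∈ B)
    (v w : E) : G m v w ≤ √(G m v v) * √(G m w w) := by
  have h := LinearMap.BilinForm.apply_mul_apply_le_of_forall_zero_le
    (ContinuousLinearMap.coeLM ℝ ∘ₗ (G m : E →ₗ[ℝ] (E →L[ℝ] ℝ)) : LinearMap.BilinForm ℝ E)
    (fun x => hG.nonneg hm x) v w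
  change G m v w * G m w v ≤ G m v v * G m w w at h
  rw [hG.symm m hm w v, ← sq] at h
  rw [← Real.sqrt_mul (hG.nonneg hm v)]
  exact (le_abs_self _).trans (Real.abs_le_sqrt h)

lemma ContinuousOn.intervalIntegrable_of_le {F : Type*} [NormedAddCommGroup F] {f : ℝ → F}
    {a b c d : ℝ} (hf : ContinuousOn f (Icc a b)) (hc : a ≤ c) (hcd : c ≤ d) (hd : d ≤ b) :
    IntervalIntegrable f volume c d :=
  (hf.mono (Icc_subset_Icc hc hd)).intervalIntegrable_of_Icc hcd

/-- The chord of a `C¹` curve is almost not longer than the curve. -/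
lemma IsRiemannianOn.chord_le [CompleteSpace E] (hG : IsRiemannianOn G B κ K) {w : ℝ → E}
    (hw : ContDiffOn ℝ 1 w (Icc 0 1)) (hwB : MapsTo w (Icc 0 1) B) {m : E} (hm : m ∈ B) {ℓ : ℝ}
    (hℓ : ∫ t in (0 : ℝ)..1, √(G (w t) (derivWithin w (Icc 0 1) t) (derivWithin w (Icc 0 1) t)) ≤ ℓ) :
    √(G m (w 1 - w 0) (w 1 - w 0)) ≤ (1 + K * (‖m - w 0‖ + ℓ / κ)) * ℓ := by
  have hud := uniqueDiffOn_Icc (zero_lt_one' ℝ)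
  have hκ := hG.ellipticity_pos
  have hK := hG.distortion_nonneg
  set w' := derivWithin w (Icc 0 1) with hw'
  have hw'c : ContinuousOn w' (Icc 0 1) := ((contDiffOn_one_iff_derivWithin hud).1 hw).2
  have hGw : ContinuousOn (fun t => G (w t)) (Icc 0 1) :=
    hG.contDiffOn.continuousOn.comp hw.continuousOn hwB
  set ν : ℝ → ℝ := fun t => √(G (w t) (w' t) (w' t)) with hν
  have hνc : ContinuousOn ν (Icc 0 1) := ((hGw.clm_apply hw'c).clm_apply hw'c).sqrt
  have hFTC : ∀ τ ∈ Icc (0 : ℝ) 1, ∫ t in (0 : ℝ)..τ, w' t = w τ - w 0 := by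
    intro τ hτ
    refine intervalIntegral.integral_eq_sub_of_hasDerivAt_of_le hτ.1
      (hw.continuousOn.mono (Icc_subset_Icc_right hτ.2)) (fun t ht => ?_)
      (hw'c.intervalIntegrable_of_le le_rfl hτ.1 hτ.2)
    have ht' : t ∈ Ioo (0 : ℝ) 1 := ⟨ht.1, ht.2.trans_le hτ.2⟩
    exact ((hw.differentiableOn one_ne_zero t (Ioo_subset_Icc_self ht')).hasDerivWithinAt).hasDerivAt
      (Icc_mem_nhds ht'.1 ht'.2)
  have hν0 : ∀ t, 0 ≤ ν t := fun t => Real.sqrt_nonneg _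
  have hℓ0 : 0 ≤ ℓ := (intervalIntegral.integral_nonneg zero_le_one fun t _ => hν0 t).trans hℓ
  -- the curve stays close to its starting point
  have hclose : ∀ τ ∈ Icc (0 : ℝ) 1, ‖w τ - w 0‖ ≤ ℓ / κ := by
    intro τ hτ
    rw [← hFTC τ hτ, le_div_iff₀ hκ, mul_comm]
    have hn : ContinuousOn (fun t => κ * ‖w' t‖) (Icc 0 1) :=
      continuousOn_const.mul hw'c.norm
    calc κ * ‖∫ t in (0 : ℝ)..τ, w' t‖ ≤ κ * ∫ t in (0 : ℝ)..τ, ‖w' t‖ := by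
          gcongr
          exact intervalIntegral.norm_integral_le_integral_norm hτ.1
      _ = ∫ t in (0 : ℝ)..τ, κ * ‖w' t‖ := (intervalIntegral.integral_const_mul _ _).symm
      _ ≤ ∫ t in (0 : ℝ)..τ, ν t := by
          refine intervalIntegral.integral_mono_on hτ.1 (hn.intervalIntegrable_of_le le_rfl hτ.1 hτ.2)
            (hνc.intervalIntegrable_of_le le_rfl hτ.1 hτ.2) fun t ht => ?_
          exact hG.ellipticity _ (hwB ⟨ht.1, ht.2.trans hτ.2⟩) _
      _ ≤ (∫ t in (0 : ℝ)..τ, ν t) + ∫ t in τ..1, ν t :=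
          le_add_of_nonneg_right (intervalIntegral.integral_nonneg hτ.2 fun t _ => hν0 t)
      _ = ∫ t in (0 : ℝ)..1, ν t := intervalIntegral.integral_add_adjacent_intervals
          (hνc.intervalIntegrable_of_le le_rfl hτ.1 hτ.2) (hνc.intervalIntegrable_of_le hτ.1 hτ.2 le_rfl)
      _ ≤ ℓ := hℓ
  set Δ := w 1 - w 0 with hΔ
  set C := 1 + K * (‖m - w 0‖ + ℓ / κ) with hC
  have hC0 : 0 ≤ C := by positivity
  -- Integrate `G m Δ (w' t)` along the curve and apply Cauchy-Schwarz. One factor `√(G m Δ Δ)` then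
  -- cancels, unless it is zero.
  have hkey : √(G m Δ Δ) * √(G m Δ Δ) ≤ √(G m Δ Δ) * (C * ℓ) := by
    rw [Real.mul_self_sqrt (hG.nonneg hm Δ)]
    calc G m Δ Δ = ∫ t in (0 : ℝ)..1, G m Δ (w' t) := by
          rw [(G m Δ).intervalIntegral_comp_comm (hw'c.intervalIntegrable_of_le le_rfl zero_le_one le_rfl),
            hFTC 1 ⟨zero_le_one, le_rfl⟩]
      _ ≤ ∫ t in (0 : ℝ)..1, √(G m Δ Δ) * (C * ν t) := by
          have h1 : ContinuousOn (fun t => G m Δ (w' t)) (Icc 0 1) :=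
            (G m Δ).continuous.comp_continuousOn hw'c
          have h2 : ContinuousOn (fun t => √(G m Δ Δ) * (C * ν t)) (Icc 0 1) :=
            continuousOn_const.mul (continuousOn_const.mul hνc)
          refine intervalIntegral.integral_mono_on zero_le_one (h1.intervalIntegrable_of_le le_rfl zero_le_one le_rfl)
            (h2.intervalIntegrable_of_le le_rfl zero_le_one le_rfl) fun t ht => ?_
          refine (hG.apply_le_sqrt_mul_sqrt hm _ _).trans ?_
          refine mul_le_mul_of_nonneg_left ?_ (Real.sqrt_nonneg _)
          refine (hG.distortion m hm _ (hwB ht) _).trans ?_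
          refine mul_le_mul_of_nonneg_right ?_ (hν0 t)
          have h3 : ‖m - w t‖ ≤ ‖m - w 0‖ + ℓ / κ := by
            have := norm_sub_le_norm_sub_add_norm_sub m (w 0) (w t)
            rw [norm_sub_rev (w 0)] at this
            linarith [hclose t ht]
          have := mul_le_mul_of_nonneg_left h3 hK
          linarith
      _ = √(G m Δ Δ) * (C * ∫ t in (0 : ℝ)..1, ν t) := by
          rw [intervalIntegral.integral_const_mul, intervalIntegral.integral_const_mul]
      _ ≤ √(G m Δ Δ) * (C * ℓ) := by gcongr
  rcases (Real.sqrt_nonneg (G m Δ Δ)).eq_or_lt with h | h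
  · rw [← h]; positivity
  · exact le_of_mul_le_mul_left hkey h

/-- A smooth Riemannian metric satisfies explicit estimates on small balls. -/
lemma exists_isRiemannianOn_ball [FiniteDimensional ℝ E] {U : Set E} (hU : IsOpen U)
    (hG : ContDiffOn ℝ ∞ G U) (hsymm : ∀ y ∈ U, ∀ v w, G y v w = G y w v)
    (hpos : ∀ y ∈ U, ∀ v, v ≠ 0 → 0 < G y v v) {x : E} (hx : x ∈ U) :
    ∃ ε κ K, 0 < ε ∧ Metric.ball x ε ⊆ U ∧ IsRiemannianOn G (Metric.ball x ε) κ K := by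
  -- Ellipticity at `x` by compactness of the unit sphere, which is empty when `E` is trivial. The
  -- factor `2` leaves the constant `c` after `G` varies by less than `c` on the ball.
  obtain ⟨c, hc, hcx⟩ : ∃ c, 0 < c ∧ ∀ v, 2 * c * ‖v‖ ^ 2 ≤ G x v v := by
    rcases (Metric.sphere (0 : E) 1).eq_empty_or_nonempty with h | h
    · refine ⟨1, one_pos, fun v => ?_⟩
      have hv : v = 0 := by
        by_contra hv
        have : ‖v‖⁻¹ • v ∈ Metric.sphere (0 : E) 1 := by
          simp [norm_smul, inv_mul_cancel₀ (norm_ne_zero_iff.2 hv)]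
        rw [h] at this
        exact this
      simp [hv]
    · have hcont : Continuous fun v : E => G x v v := by fun_prop
      obtain ⟨v₀, hv₀, hmin⟩ := (isCompact_sphere (0 : E) 1).exists_isMinOn h hcont.continuousOn
      have hv₀' : v₀ ≠ 0 := by
        rintro rfl
        simp at hv₀
      refine ⟨G x v₀ v₀ / 2, half_pos (hpos x hx v₀ hv₀'), fun v => ?_⟩
      rcases eq_or_ne v 0 with rfl | hv
      · simp
      have hn : 0 < ‖v‖ := norm_pos_iff.2 hv
      have h1 := hmin (show ‖v‖⁻¹ • v ∈ Metric.sphere (0 : E) 1 by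
          simp [norm_smul, inv_mul_cancel₀ hn.ne'])
      simp only [mem_ofPred_eq, map_smul, _root_.smul_apply, smul_eq_mul] at h1
      calc 2 * (G x v₀ v₀ / 2) * ‖v‖ ^ 2 = G x v₀ v₀ * ‖v‖ ^ 2 := by ring
        _ ≤ (‖v‖⁻¹ * (‖v‖⁻¹ * G x v v)) * ‖v‖ ^ 2 := by gcongr
        _ = G x v v := by field_simp
  have hat : ContDiffAt ℝ 1 G x :=
    (hG.contDiffAt (hU.mem_nhds hx)).of_le (by exact_mod_cast le_top)
  obtain ⟨L, t, ht, hL⟩ := hat.exists_lipschitzOnWith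
  have hnear : ∀ᶠ y in 𝓝 x, ‖G y - G x‖ < c := by
    have := hat.continuousAt.eventually (Metric.ball_mem_nhds (G x) hc)
    filter_upwards [this] with y hy
    rwa [← dist_eq_norm]
  obtain ⟨ε, hε, hsub⟩ := Metric.mem_nhds_iff.1
    (inter_mem (inter_mem ht hnear) (hU.mem_nhds hx))
  have hdiff : ∀ (A A' : E →L[ℝ] E →L[ℝ] ℝ) (v : E), A v v ≤ A' v v + ‖A - A'‖ * ‖v‖ ^ 2 := by
    intro A A' v
    have h1 := (Real.le_norm_self _).trans ((A - A').le_opNorm₂ v v)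
    simp only [_root_.sub_apply] at h1
    rw [sq]
    linarith
  have hell : ∀ y ∈ Metric.ball x ε, ∀ v, c * ‖v‖ ^ 2 ≤ G y v v := by
    intro y hy v
    have h1 := hdiff (G x) (G y) v
    have h2 : ‖G x - G y‖ < c := by rw [norm_sub_rev]; exact (hsub hy).1.2
    have h3 : ‖G x - G y‖ * ‖v‖ ^ 2 ≤ c * ‖v‖ ^ 2 := by gcongr
    linarith [hcx v]
  refine ⟨ε, √c, L / c, hε, fun y hy => (hsub hy).2, Metric.isOpen_ball, convex_ball x ε,
    hG.mono fun y hy => (hsub hy).2, fun y hy => hsymm y (hsub hy).2, Real.sqrt_pos.2 hc, ?_,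
    by positivity, ?_⟩
  · intro y hy v
    rw [← Real.sqrt_sq (norm_nonneg v), ← Real.sqrt_mul hc.le]
    exact Real.sqrt_le_sqrt (hell y hy v)
  · intro y hy z hz v
    have h1 := hdiff (G y) (G z) v
    have h2 : ‖G y - G z‖ ≤ L * ‖y - z‖ := by
      rw [← dist_eq_norm, ← dist_eq_norm]
      exact hL.dist_le_mul y (hsub hy).1.1 z (hsub hz).1.1
    have h3 := hell z hz v
    have h4 : ‖G y - G z‖ * ‖v‖ ^ 2 ≤ (L / c * ‖y - z‖) * G z v v := by
      calc ‖G y - G z‖ * ‖v‖ ^ 2 ≤ (L * ‖y - z‖) * ‖v‖ ^ 2 := by gcongr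
        _ = (L / c * ‖y - z‖) * (c * ‖v‖ ^ 2) := by field_simp
        _ ≤ _ := by gcongr
    have h5 : 0 ≤ L / c * ‖y - z‖ := by positivity
    have h0 : 0 ≤ G z v v := le_trans (by positivity) h3
    -- The Lipschitz bound gives the factor `1 + L / c * ‖y - z‖`; it is at most its own square,
    -- which suits the square root taken next.
    have h6 : G y v v ≤ (1 + L / c * ‖y - z‖) ^ 2 * G z v v := by
      nlinarith [mul_nonneg h5 h0, mul_nonneg (mul_nonneg h5 h5) h0]
    calc √(G y v v) ≤ √((1 + L / c * ‖y - z‖) ^ 2 * G z v v) := Real.sqrt_le_sqrt h6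
      _ = (1 + L / c * ‖y - z‖) * √(G z v v) := by
        rw [Real.sqrt_mul (sq_nonneg _), Real.sqrt_sq (by positivity)]

end LocalMetric


/-! ### A Riemannian metric read in a chart -/

section ChartMetric

set_option maxSynthPendingDepth 3

open MeasureTheory Manifold

variable {E : Type*} [NormedAddCommGroup E] [NormedSpace ℝ E]
  {S : Type*} [TopologicalSpace S] [ChartedSpace E S] [IsManifold 𝓘(ℝ, E) ∞ S]

/-- The metric `k` read in the chart at `x`. -/
noncomputable def chartMetric
    (k : ContMDiffRiemannianMetric 𝓘(ℝ, E) ∞ E (fun p : S => TangentSpace 𝓘(ℝ, E) p))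
    (x : S) (y : E) : E →L[ℝ] E →L[ℝ] ℝ :=
  let D : E →L[ℝ] TangentSpace 𝓘(ℝ, E) ((extChartAt 𝓘(ℝ, E) x).symm y) :=
    mfderiv 𝓘(ℝ, E) 𝓘(ℝ, E) (extChartAt 𝓘(ℝ, E) x).symm y
  (ContinuousLinearMap.precomp ℝ D).comp ((k.inner ((extChartAt 𝓘(ℝ, E) x).symm y)).comp D)

variable (k : ContMDiffRiemannianMetric 𝓘(ℝ, E) ∞ E (fun p : S => TangentSpace 𝓘(ℝ, E) p))

lemma chartMetric_apply (x : S) (y v w : E) :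
    chartMetric k x y v w = k.inner ((extChartAt 𝓘(ℝ, E) x).symm y)
      (mfderiv 𝓘(ℝ, E) 𝓘(ℝ, E) (extChartAt 𝓘(ℝ, E) x).symm y v)
      (mfderiv 𝓘(ℝ, E) 𝓘(ℝ, E) (extChartAt 𝓘(ℝ, E) x).symm y w) := rfl

/-- This is the tangent map of the smooth inverse chart applied to a constant vector field. -/
lemma contMDiffOn_mfderiv_extChartAt_symm (x : S) (v : E) :
    ContMDiffOn 𝓘(ℝ, E) (𝓘(ℝ, E).prod 𝓘(ℝ, E)) ∞
      (fun y : E => (⟨(extChartAt 𝓘(ℝ, E) x).symm y,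
        mfderiv 𝓘(ℝ, E) 𝓘(ℝ, E) (extChartAt 𝓘(ℝ, E) x).symm y v⟩ : TangentBundle 𝓘(ℝ, E) S))
      (extChartAt 𝓘(ℝ, E) x).target := by
  have ho : IsOpen (extChartAt 𝓘(ℝ, E) x).target := isOpen_extChartAt_target x
  have h1 := (contMDiffOn_extChartAt_symm (I := 𝓘(ℝ, E)) (n := ∞) x).contMDiffOn_tangentMapWithin
    (m := ∞) (by simp) ho.uniqueMDiffOn
  have h2 : ContMDiff 𝓘(ℝ, E) (𝓘(ℝ, E).prod 𝓘(ℝ, E)) ∞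
      (fun y : E => (⟨y, v⟩ : TangentBundle 𝓘(ℝ, E) E)) := by
    intro y
    refine (Bundle.contMDiffAt_section (E := fun y : E => TangentSpace 𝓘(ℝ, E) y) y).2 ?_
    simpa using contMDiffAt_const
  have h3 := h1.comp (h2.contMDiffOn (s := (extChartAt 𝓘(ℝ, E) x).target)) fun y hy => hy
  refine h3.congr fun y hy => ?_
  simp only [Function.comp_apply, tangentMapWithin]
  rw [mfderivWithin_of_isOpen ho hy]

/-- In finite dimension smoothness may be tested on fixed vectors `v`, `w`. The resulting
coefficient is the smooth metric evaluated on two smooth vector fields along the inverse chart. -/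
lemma contDiffOn_chartMetric [FiniteDimensional ℝ E] (x : S) :
    ContDiffOn ℝ ∞ (chartMetric k x) (extChartAt 𝓘(ℝ, E) x).target := by
  rw [contDiffOn_clm_apply]
  intro v
  rw [contDiffOn_clm_apply]
  intro w
  rw [← contMDiffOn_iff_contDiffOn]
  intro y hy
  have h1 := contMDiffOn_mfderiv_extChartAt_symm x v y hy
  have h2 := contMDiffOn_mfderiv_extChartAt_symm x w y hy
  have h3 : ContMDiffWithinAt 𝓘(ℝ, E) (𝓘(ℝ, E).prod 𝓘(ℝ)) ∞
      (fun y => TotalSpace.mk' ℝ (E := Bundle.Trivial S ℝ) ((extChartAt 𝓘(ℝ, E) x).symm y)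
        (chartMetric k x y v w)) (extChartAt 𝓘(ℝ, E) x).target y := by
    refine ContMDiffWithinAt.clm_bundle_apply₂ (𝕜 := ℝ) (F₁ := E) (F₂ := E) (F₃ := ℝ)
      (E₁ := fun p : S => TangentSpace 𝓘(ℝ, E) p) (E₂ := fun p : S => TangentSpace 𝓘(ℝ, E) p)
      (E₃ := Bundle.Trivial S ℝ)
      (v := fun y => mfderiv 𝓘(ℝ, E) 𝓘(ℝ, E) (extChartAt 𝓘(ℝ, E) x).symm y v)
      (w := fun y => mfderiv 𝓘(ℝ, E) 𝓘(ℝ, E) (extChartAt 𝓘(ℝ, E) x).symm y w)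
      (ψ := fun y => k.inner ((extChartAt 𝓘(ℝ, E) x).symm y)) ?_ ?_ ?_
    · exact k.contMDiff.contMDiffAt.comp_contMDiffWithinAt y
        (contMDiffOn_extChartAt_symm x y hy)
    · exact h1
    · exact h2
  simp only [contMDiffWithinAt_totalSpace] at h3
  exact h3.2

/-- The derivative of the inverse chart is injective: the chart composed with its inverse is the
identity near `y`. -/
lemma chartMetric_pos (x : S) {y : E} (hy : y ∈ (extChartAt 𝓘(ℝ, E) x).target) {v : E}
    (hv : v ≠ 0) : 0 < chartMetric k x y v v := by
  rw [chartMetric_apply]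
  refine k.pos _ _ fun h0 => hv ?_
  have h1 : MDifferentiableAt 𝓘(ℝ, E) 𝓘(ℝ, E) (extChartAt 𝓘(ℝ, E) x).symm y :=
    ((contMDiffOn_extChartAt_symm (I := 𝓘(ℝ, E)) (n := ∞) x).contMDiffAt
      ((isOpen_extChartAt_target x).mem_nhds hy)).mdifferentiableAt (by simp)
  have h2 : MDifferentiableAt 𝓘(ℝ, E) 𝓘(ℝ, E) (extChartAt 𝓘(ℝ, E) x)
      ((extChartAt 𝓘(ℝ, E) x).symm y) := by
    refine mdifferentiableAt_extChartAt ?_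
    rw [← extChartAt_source 𝓘(ℝ, E) x]
    exact (extChartAt 𝓘(ℝ, E) x).map_target hy
  have h3 := mfderiv_comp y h2 h1
  have h4 : (extChartAt 𝓘(ℝ, E) x ∘ (extChartAt 𝓘(ℝ, E) x).symm) =ᶠ[𝓝 y] id := by
    filter_upwards [(isOpen_extChartAt_target (I := 𝓘(ℝ, E)) x).mem_nhds hy] with z hz
    exact (extChartAt 𝓘(ℝ, E) x).right_inv hz
  rw [h4.mfderiv_eq, mfderiv_id] at h3
  have h5 : v = mfderiv 𝓘(ℝ, E) 𝓘(ℝ, E) (extChartAt 𝓘(ℝ, E) x)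
      ((extChartAt 𝓘(ℝ, E) x).symm y)
        (mfderiv 𝓘(ℝ, E) 𝓘(ℝ, E) (extChartAt 𝓘(ℝ, E) x).symm y v) :=
    congrArg (fun L : E →L[ℝ] E => L v) h3
  rw [h5, h0, map_zero]
  rfl

lemma mfderivWithin_extChartAt_symm_comp (x : S) {w : ℝ → E} {J : Set ℝ} {s : ℝ}
    (hw : DifferentiableWithinAt ℝ w J s) (hJ : UniqueDiffWithinAt ℝ J s)
    (hs : w s ∈ (extChartAt 𝓘(ℝ, E) x).target) :
    mfderivWithin 𝓘(ℝ, ℝ) 𝓘(ℝ, E) ((extChartAt 𝓘(ℝ, E) x).symm ∘ w) J s 1 =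
      mfderiv 𝓘(ℝ, E) 𝓘(ℝ, E) (extChartAt 𝓘(ℝ, E) x).symm (w s) (derivWithin w J s) := by
  have h1 : MDifferentiableAt 𝓘(ℝ, E) 𝓘(ℝ, E) (extChartAt 𝓘(ℝ, E) x).symm (w s) :=
    ((contMDiffOn_extChartAt_symm (I := 𝓘(ℝ, E)) (n := ∞) x).contMDiffAt
      ((isOpen_extChartAt_target x).mem_nhds hs)).mdifferentiableAt (by simp)
  rw [mfderiv_comp_mfderivWithin s h1 hw.mdifferentiableWithinAt hJ.uniqueMDiffWithinAt,
    mfderivWithin_eq_fderivWithin]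
  rfl

end ChartMetric


/-! ### Length and distance of a Riemannian metric -/

section MetricLength

open MeasureTheory Manifold

variable {E : Type*} [NormedAddCommGroup E] [NormedSpace ℝ E]
  {S : Type*} [TopologicalSpace S] [ChartedSpace E S] [IsManifold 𝓘(ℝ, E) ∞ S]
  (k : ContMDiffRiemannianMetric 𝓘(ℝ, E) ∞ E (fun p : S => TangentSpace 𝓘(ℝ, E) p))

/-- The `k`-norm of the velocity at `s` of a curve `γ : J → S`. -/
noncomputable def metricSpeed (γ : ℝ → S) (J : Set ℝ) (s : ℝ) : ℝ :=
  √(k.inner (γ s) (mfderivWithin 𝓘(ℝ, ℝ) 𝓘(ℝ, E) γ J s 1)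
    (mfderivWithin 𝓘(ℝ, ℝ) 𝓘(ℝ, E) γ J s 1))

/-- The `k`-length of a curve `γ : [a, b] → S`. -/
noncomputable def metricLength (γ : ℝ → S) (a b : ℝ) : ENNReal :=
  ∫⁻ s in Icc a b, ENNReal.ofReal (metricSpeed k γ (Icc a b) s)

/-- Links the length for an explicit metric `k` to the one defined through a bundle instance, so
that the latter's theory applies without fixing an instance on the tangent bundle. -/
lemma pathELength_eq_metricLength (γ : ℝ → S) (a b : ℝ) :
    letI : RiemannianBundle (fun p : S => TangentSpace 𝓘(ℝ, E) p) := ⟨k.toRiemannianMetric⟩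
    pathELength 𝓘(ℝ, E) γ a b = metricLength k γ a b := by
  let : RiemannianBundle (fun p : S => TangentSpace 𝓘(ℝ, E) p) := ⟨k.toRiemannianMetric⟩
  rw [pathELength_eq_lintegral_mfderivWithin_Icc, metricLength]
  refine lintegral_congr fun s => ?_
  rw [← ofReal_norm, metricSpeed]
  exact congrArg ENNReal.ofReal (norm_eq_sqrt_real_inner
    (F := TangentSpace 𝓘(ℝ, E) (γ s)) (mfderivWithin 𝓘(ℝ, ℝ) 𝓘(ℝ, E) γ (Icc a b) s 1))

variable {k}

lemma metricEDist_le_metricLength {γ : ℝ → S} {a b : ℝ} (hab : a ≤ b)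
    (hγ : ContMDiffOn 𝓘(ℝ, ℝ) 𝓘(ℝ, E) 1 γ (Icc a b)) :
    metricEDist k (γ a) (γ b) ≤ metricLength k γ a b := by
  let : RiemannianBundle (fun p : S => TangentSpace 𝓘(ℝ, E) p) := ⟨k.toRiemannianMetric⟩
  rw [← pathELength_eq_metricLength]
  exact riemannianEDist_le_pathELength hγ rfl rfl hab

lemma metricLength_add {γ : ℝ → S} {a b c : ℝ} (hab : a ≤ b) (hbc : b ≤ c) :
    metricLength k γ a b + metricLength k γ b c = metricLength k γ a c := by
  let : RiemannianBundle (fun p : S => TangentSpace 𝓘(ℝ, E) p) := ⟨k.toRiemannianMetric⟩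
  simp only [← pathELength_eq_metricLength]
  exact pathELength_add hab hbc

lemma metricLength_congr {γ γ' : ℝ → S} {a b : ℝ} (h : EqOn γ γ' (Icc a b)) :
    metricLength k γ a b = metricLength k γ' a b := by
  let : RiemannianBundle (fun p : S => TangentSpace 𝓘(ℝ, E) p) := ⟨k.toRiemannianMetric⟩
  simp only [← pathELength_eq_metricLength]
  exact pathELength_congr h

lemma exists_metricLength_lt_of_metricEDist_lt {x y : S} {r : ENNReal}
    (h : metricEDist k x y < r) :
    ∃ γ : ℝ → S, γ 0 = x ∧ γ 1 = y ∧ ContMDiffOn 𝓘(ℝ, ℝ) 𝓘(ℝ, E) 1 γ (Icc 0 1) ∧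
      metricLength k γ 0 1 < r := by
  let : RiemannianBundle (fun p : S => TangentSpace 𝓘(ℝ, E) p) := ⟨k.toRiemannianMetric⟩
  simp only [← pathELength_eq_metricLength]
  exact exists_lt_of_riemannianEDist_lt h

lemma metricEDist_le_metricLength_of_mem {γ : ℝ → S} {a b t : ℝ} (ht : t ∈ Icc a b)
    (hγ : ContMDiffOn 𝓘(ℝ, ℝ) 𝓘(ℝ, E) 1 γ (Icc a b)) :
    metricEDist k (γ a) (γ t) ≤ metricLength k γ a b := by
  rw [← metricLength_add ht.1 ht.2]
  exact (metricEDist_le_metricLength ht.1 (hγ.mono (Icc_subset_Icc_right ht.2))).trans le_self_add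

variable (k)

/-- The distance of the Riemannian metric `k`, inducing the topology of the manifold. -/
@[reducible] noncomputable def metricEMetricSpace [FiniteDimensional ℝ E] [T2Space S] :
    EMetricSpace S :=
  letI : RiemannianBundle (fun p : S => TangentSpace 𝓘(ℝ, E) p) := ⟨k.toRiemannianMetric⟩
  haveI : IsContinuousRiemannianBundle E (fun p : S => TangentSpace 𝓘(ℝ, E) p) :=
    ⟨k.inner, k.contMDiff.continuous, fun _ _ _ => rfl⟩
  haveI : LocallyCompactSpace S := Manifold.locallyCompact_of_finiteDimensional 𝓘(ℝ, E)
  EMetricSpace.ofRiemannianMetric 𝓘(ℝ, E) S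

/-- On a curve of length less than `r + s` some point is at distance exactly `r` from `x`, by the
intermediate value theorem. The arc up to it uses up length at least `r`, so what remains is shorter
than `s`. -/
lemma hasApproxIntermediatePoints_metricEMetricSpace [FiniteDimensional ℝ E] [T2Space S] :
    @HasApproxIntermediatePoints S (metricEMetricSpace k) := by
  let := metricEMetricSpace k
  intro x y r s hs hxy
  rcases le_or_gt (edist x y) r with h | h
  · exact ⟨y, h, by simp⟩
  have hxy' : metricEDist k x y < r + s := hxy
  obtain ⟨γ, h0, h1, hγ, hL⟩ := exists_metricLength_lt_of_metricEDist_lt hxy'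
  have hf : ContinuousOn (fun τ => edist x (γ τ)) (Icc 0 1) :=
    (continuous_const.edist continuous_id).comp_continuousOn hγ.continuousOn
  obtain ⟨τ, hτ, hτr⟩ : r ∈ (fun τ => edist x (γ τ)) '' Icc 0 1 := by
    refine intermediate_value_Icc zero_le_one hf ⟨?_, ?_⟩
    · simp [h0]
    · simpa [h1] using h.le
  refine ⟨γ τ, hτr.le, ?_⟩
  rw [← metricLength_add hτ.1 hτ.2] at hL
  have h2 : r ≤ metricLength k γ 0 τ := by
    rw [← hτr, ← h0]
    exact metricEDist_le_metricLength hτ.1 (hγ.mono (Icc_subset_Icc_right hτ.2))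
  have h3 : edist (γ τ) y ≤ metricLength k γ τ 1 := by
    rw [← h1]
    exact metricEDist_le_metricLength hτ.2 (hγ.mono (Icc_subset_Icc_left hτ.1))
  refine h3.trans ?_
  by_contra! h4
  exact absurd hL (not_lt.2 (add_le_add h2 h4.le))

end MetricLength

/-! ### Comparison of lengths in the manifold and in a chart -/

section ChartLength

set_option maxSynthPendingDepth 3

open MeasureTheory Manifold

variable {E : Type*} [NormedAddCommGroup E] [NormedSpace ℝ E] [FiniteDimensional ℝ E]
  {S : Type*} [TopologicalSpace S] [ChartedSpace E S] [IsManifold 𝓘(ℝ, E) ∞ S]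
  {k : ContMDiffRiemannianMetric 𝓘(ℝ, E) ∞ E (fun p : S => TangentSpace 𝓘(ℝ, E) p)}

omit [FiniteDimensional ℝ E] in
lemma metricSpeed_extChartAt_symm_comp (x : S) {w : ℝ → E} {J : Set ℝ} {s : ℝ}
    (hw : DifferentiableWithinAt ℝ w J s) (hJ : UniqueDiffWithinAt ℝ J s)
    (hs : w s ∈ (extChartAt 𝓘(ℝ, E) x).target) :
    metricSpeed k ((extChartAt 𝓘(ℝ, E) x).symm ∘ w) J s =
      √(chartMetric k x (w s) (derivWithin w J s) (derivWithin w J s)) := by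
  rw [metricSpeed, mfderivWithin_extChartAt_symm_comp x hw hJ hs, chartMetric_apply]
  rfl

lemma metricLength_extChartAt_symm_comp (x : S) {w : ℝ → E} {a b : ℝ} (hab : a ≤ b)
    (hw : ContDiffOn ℝ 1 w (Icc a b)) (hs : MapsTo w (Icc a b) (extChartAt 𝓘(ℝ, E) x).target) :
    metricLength k ((extChartAt 𝓘(ℝ, E) x).symm ∘ w) a b = ENNReal.ofReal (∫ t in a..b,
      √(chartMetric k x (w t) (derivWithin w (Icc a b) t) (derivWithin w (Icc a b) t))) := by
  rcases hab.eq_or_lt with rfl | hab'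
  · simp [metricLength]
  have hu := uniqueDiffOn_Icc hab'
  have hc : ContinuousOn (fun t => √(chartMetric k x (w t) (derivWithin w (Icc a b) t)
      (derivWithin w (Icc a b) t))) (Icc a b) := by
    have h1 := (contDiffOn_chartMetric k x).continuousOn.comp hw.continuousOn hs
    have h2 := hw.continuousOn_derivWithin hu le_rfl
    exact ((h1.clm_apply h2).clm_apply h2).sqrt
  rw [metricLength, intervalIntegral.integral_of_le hab, ← integral_Icc_eq_integral_Ioc,
    ofReal_integral_eq_lintegral_ofReal (hc.integrableOn_compact isCompact_Icc)
      (Eventually.of_forall fun t => Real.sqrt_nonneg _)]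
  refine setLIntegral_congr_fun measurableSet_Icc fun t ht => ?_
  rw [metricSpeed_extChartAt_symm_comp x (hw.differentiableOn one_ne_zero t ht) (hu t ht) (hs ht)]

lemma metricEDist_extChartAt_symm_le (x : S) {w : ℝ → E} {a b : ℝ} (hab : a ≤ b)
    (hw : ContDiffOn ℝ 1 w (Icc a b)) (hs : MapsTo w (Icc a b) (extChartAt 𝓘(ℝ, E) x).target) :
    metricEDist k ((extChartAt 𝓘(ℝ, E) x).symm (w a)) ((extChartAt 𝓘(ℝ, E) x).symm (w b)) ≤
      ENNReal.ofReal (∫ t in a..b,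
        √(chartMetric k x (w t) (derivWithin w (Icc a b) t) (derivWithin w (Icc a b) t))) := by
  rw [← metricLength_extChartAt_symm_comp x hab hw hs]
  refine metricEDist_le_metricLength (γ := (extChartAt 𝓘(ℝ, E) x).symm ∘ w) hab ?_
  exact (contMDiffOn_extChartAt_symm (n := 1) x).comp hw.contMDiffOn hs

/-- Two points at distance less than `ℓ` are joined by a curve of length at most `ℓ` in the image
of the chart at `x`, if the points near them are in the part `U` of the chart. -/
lemma exists_chart_path_of_metricEDist_lt (x : S) {U : Set E} {y z : S} {ℓ : ℝ}
    (hyz : metricEDist k y z < ENNReal.ofReal ℓ)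
    (hU : ∀ q, metricEDist k y q < ENNReal.ofReal ℓ →
      q ∈ (extChartAt 𝓘(ℝ, E) x).source ∧ extChartAt 𝓘(ℝ, E) x q ∈ U) :
    ∃ w : ℝ → E, w 0 = extChartAt 𝓘(ℝ, E) x y ∧ w 1 = extChartAt 𝓘(ℝ, E) x z ∧
      ContDiffOn ℝ 1 w (Icc 0 1) ∧ MapsTo w (Icc 0 1) U ∧
      ∫ t in (0 : ℝ)..1, √(chartMetric k x (w t) (derivWithin w (Icc 0 1) t)
        (derivWithin w (Icc 0 1) t)) ≤ ℓ := by
  obtain ⟨γ, rfl, rfl, hγ, hL⟩ := exists_metricLength_lt_of_metricEDist_lt hyz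
  -- Each point of a curve of length less than `ℓ` is at distance less than `ℓ` from its start, so
  -- the whole curve stays in the chart.
  have h1 : ∀ t ∈ Icc (0 : ℝ) 1, γ t ∈ (extChartAt 𝓘(ℝ, E) x).source ∧
      extChartAt 𝓘(ℝ, E) x (γ t) ∈ U := fun t ht =>
    hU _ ((metricEDist_le_metricLength_of_mem ht hγ).trans_lt hL)
  have h2 : ContDiffOn ℝ 1 (extChartAt 𝓘(ℝ, E) x ∘ γ) (Icc 0 1) := by
    rw [← contMDiffOn_iff_contDiffOn]
    refine (contMDiffOn_extChartAt (I := 𝓘(ℝ, E)) (n := 1) (x := x)).comp hγ ?_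
    intro t ht
    rw [mem_preimage, ← extChartAt_source 𝓘(ℝ, E) x]
    exact (h1 t ht).1
  refine ⟨extChartAt 𝓘(ℝ, E) x ∘ γ, rfl, rfl, h2, fun t ht => (h1 t ht).2, ?_⟩
  have hmt : MapsTo (extChartAt 𝓘(ℝ, E) x ∘ γ) (Icc 0 1) (extChartAt 𝓘(ℝ, E) x).target :=
    fun t ht => (extChartAt 𝓘(ℝ, E) x).map_source (h1 t ht).1
  have h3 := metricLength_extChartAt_symm_comp (k := k) x zero_le_one h2 hmt
  have h4 : EqOn ((extChartAt 𝓘(ℝ, E) x).symm ∘ extChartAt 𝓘(ℝ, E) x ∘ γ) γ (Icc 0 1) :=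
    fun t ht => (extChartAt 𝓘(ℝ, E) x).left_inv (h1 t ht).1
  rw [metricLength_congr h4] at h3
  rw [h3] at hL
  exact (ENNReal.ofReal_lt_ofReal_iff_of_nonneg
    (intervalIntegral.integral_nonneg zero_le_one fun t _ => Real.sqrt_nonneg _)).1 hL |>.le

end ChartLength


/-! ### Smoothness of distance-realizing curves in the manifold -/

section Geodesics

set_option maxSynthPendingDepth 3

variable {E : Type*} [NormedAddCommGroup E] [NormedSpace ℝ E] [FiniteDimensional ℝ E]
  {S : Type*} [TopologicalSpace S] [ChartedSpace E S] [IsManifold 𝓘(ℝ, E) ∞ S]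
  {k : ContMDiffRiemannianMetric 𝓘(ℝ, E) ∞ E (fun p : S => TangentSpace 𝓘(ℝ, E) p)}

/-- Curves in the chart are curves in the manifold, so their lengths bound distances from above.
Conversely, nearly shortest curves between points of `c` cannot leave the chart, by `hcB`, and the
chord estimate for them gives the one for `c`. -/
lemma isMinimizingOn_extChartAt_comp (x : S) {B : Set E} {κ K : ℝ}
    (hG : IsRiemannianOn (chartMetric k x) B κ K) (hB : B ⊆ (extChartAt 𝓘(ℝ, E) x).target)
    {c : ℝ → S} {a b ρ : ℝ} (hρ : 0 < ρ)
    (hc : ∀ s ∈ Icc a b, ∀ s' ∈ Icc a b, metricEDist k (c s) (c s') = ENNReal.ofReal |s - s'|)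
    (hcB : ∀ s ∈ Icc a b, ∀ q, metricEDist k (c s) q < ENNReal.ofReal (b - a + ρ) →
      q ∈ (extChartAt 𝓘(ℝ, E) x).source ∧ extChartAt 𝓘(ℝ, E) x q ∈ B) :
    IsMinimizingOn (chartMetric k x) B (K * (1 + 1 / κ)) (extChartAt 𝓘(ℝ, E) x ∘ c) a b := by
  have hκ := hG.ellipticity_pos
  have hK := hG.distortion_nonneg
  have hmem : ∀ s ∈ Icc a b,
      c s ∈ (extChartAt 𝓘(ℝ, E) x).source ∧ extChartAt 𝓘(ℝ, E) x (c s) ∈ B := by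
    intro s hs
    refine hcB s hs _ ?_
    rw [hc s hs s hs]
    simpa using by linarith [hs.1, hs.2]
  refine ⟨fun s hs => (hmem s hs).2, ?_, ?_⟩
  · intro s hs s' hs' hss α β w hαβ hw hwB hwα hwβ
    have h1 := metricEDist_extChartAt_symm_le (k := k) x hαβ hw (hwB.mono_right hB)
    rw [hwα, hwβ, Function.comp_apply, Function.comp_apply,
      (extChartAt 𝓘(ℝ, E) x).left_inv (hmem s hs).1,
      (extChartAt 𝓘(ℝ, E) x).left_inv (hmem s' hs').1, hc s hs s' hs',
      ENNReal.ofReal_le_ofReal_iff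
        (intervalIntegral.integral_nonneg hαβ fun t _ => Real.sqrt_nonneg _),
      abs_sub_comm, abs_of_nonneg (sub_nonneg.2 hss)] at h1
    exact h1
  · intro s hs s' hs' hss m hm
    set u := extChartAt 𝓘(ℝ, E) x ∘ c with hu
    -- A shortest connecting curve in the chart is not available, so curves of length at most `s' -
    -- s + r` are used and `r` tends to `0`.
    have key : ∀ᶠ r in 𝓝[>] (0 : ℝ), √(chartMetric k x m (u s' - u s) (u s' - u s)) ≤
        (1 + K * (‖m - u s‖ + (s' - s + r) / κ)) * (s' - s + r) := by
      filter_upwards [Ioo_mem_nhdsGT hρ] with r hr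
      obtain ⟨w, hw0, hw1, hw, hwB, hℓ⟩ := exists_chart_path_of_metricEDist_lt (k := k) x
        (U := B) (y := c s) (z := c s') (ℓ := s' - s + r) (by
          rw [hc s hs s' hs', abs_sub_comm, abs_of_nonneg (sub_nonneg.2 hss)]
          exact (ENNReal.ofReal_lt_ofReal_iff (by linarith [hr.1])).2 (by linarith [hr.1]))
        (fun q hq => hcB s hs q (hq.trans_le (ENNReal.ofReal_le_ofReal
          (by linarith [hr.2, hs.1, hs'.2]))))
      have := hG.chord_le hw hwB hm hℓ
      rwa [hw0, hw1] at this
    have hlim : Tendsto (fun r : ℝ => (1 + K * (‖m - u s‖ + (s' - s + r) / κ)) * (s' - s + r))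
        (𝓝[>] 0) (𝓝 ((1 + K * (‖m - u s‖ + (s' - s + 0) / κ)) * (s' - s + 0))) := by
      refine Tendsto.mono_left (Continuous.tendsto ?_ 0) nhdsWithin_le_nhds
      fun_prop
    refine (ge_of_tendsto hlim key).trans ?_
    rw [add_zero]
    have h0 : 0 ≤ s' - s := sub_nonneg.2 hss
    refine mul_le_mul_of_nonneg_right ?_ h0
    -- The factor `1 + 1 / κ` bounds the coefficients `1` and `1 / κ` simultaneously; hence the
    -- constant `K * (1 + 1 / κ)`.
    have h2 : ‖m - u s‖ + (s' - s) / κ ≤ (1 + 1 / κ) * (‖m - u s‖ + (s' - s)) := by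
      have h3 : 0 ≤ 1 / κ * ‖m - u s‖ := by positivity
      have h4 : (s' - s) / κ = 1 / κ * (s' - s) := by ring
      rw [h4]
      linarith
    rw [mul_assoc]
    gcongr

variable (k) in
lemma exists_metricEDist_lt_subset_of_mem_nhds [T2Space S] {x : S} {U : Set S} (hU : U ∈ 𝓝 x) :
    ∃ ρ : ℝ, 0 < ρ ∧ ∀ q, metricEDist k x q < ENNReal.ofReal ρ → q ∈ U := by
  let := metricEMetricSpace k
  obtain ⟨ρ, hρ, h⟩ := Metric.nhds_basis_eball.mem_iff.1 hU
  obtain ⟨ρ', h0, h1⟩ := ENNReal.lt_iff_exists_real_btwn.1 hρ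
  refine ⟨ρ', by simpa using h1.1, fun q hq => h ?_⟩
  rw [Metric.mem_eball, edist_comm]
  exact lt_trans hq h1.2

omit [FiniteDimensional ℝ E] in
lemma metricSpeed_congr {γ γ' : ℝ → S} {J : Set ℝ} (h : EqOn γ γ' J) {s : ℝ} (hs : s ∈ J) :
    metricSpeed k γ J s = metricSpeed k γ' J s := by
  have h1 : (mfderivWithin 𝓘(ℝ, ℝ) 𝓘(ℝ, E) γ J s : ℝ →L[ℝ] E) =
      mfderivWithin 𝓘(ℝ, ℝ) 𝓘(ℝ, E) γ' J s := mfderivWithin_congr h (h hs)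
  exact congrArg₂ (fun (p : S) (v : ℝ →L[ℝ] E) => √(k.inner p (v 1 : E) (v 1 : E))) (h hs) h1

omit [FiniteDimensional ℝ E] in
lemma metricSpeed_congr_set {γ : ℝ → S} {J J' : Set ℝ} {s : ℝ} (h : J =ᶠ[𝓝 s] J') :
    metricSpeed k γ J s = metricSpeed k γ J' s := by
  rw [metricSpeed, metricSpeed, mfderivWithin_congr_set h]

/-- A curve which is parametrized by arclength and realizes the distance between its points is
smooth. -/
theorem contMDiffOn_of_metricEDist_eq [T2Space S] {c : ℝ → S} {R : ℝ}
    (hc : ∀ s ∈ Ico 0 R, ∀ s' ∈ Ico 0 R, metricEDist k (c s) (c s') = ENNReal.ofReal |s - s'|) :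
    ContMDiffOn 𝓘(ℝ, ℝ) 𝓘(ℝ, E) ∞ c (Ico 0 R) ∧
      ∀ s ∈ Ico 0 R, metricSpeed k c (Ico 0 R) s ≤ 1 := by
  suffices H : ∀ s₀ ∈ Ico 0 R, ContMDiffWithinAt 𝓘(ℝ, ℝ) 𝓘(ℝ, E) ∞ c (Ico 0 R) s₀ ∧
      metricSpeed k c (Ico 0 R) s₀ ≤ 1 from
    ⟨fun s hs => (H s hs).1, fun s hs => (H s hs).2⟩
  intro s₀ hs₀
  set x := c s₀ with hx
  set φ := extChartAt 𝓘(ℝ, E) x with hφ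
  obtain ⟨ε, κ, K, hε, hεt, hG⟩ := exists_isRiemannianOn_ball (isOpen_extChartAt_target x)
    (contDiffOn_chartMetric k x) (fun y _ v w => k.symm _ _ _)
    (fun y hy v hv => chartMetric_pos k x hy hv) (mem_extChartAt_target x)
  have hnhds : φ.source ∩ φ ⁻¹' Metric.ball (φ x) ε ∈ 𝓝 x :=
    inter_mem (extChartAt_source_mem_nhds x)
      ((continuousAt_extChartAt x).preimage_mem_nhds (Metric.ball_mem_nhds _ hε))
  obtain ⟨ρ, hρ, hρU⟩ := exists_metricEDist_lt_subset_of_mem_nhds k hnhds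
  -- Points of the interval used are within `2δ` of `s₀`, its length is at most `3δ`, and `5δ + ρ /
  -- 8 < ρ`, so the relevant balls lie in the chart. The second bound keeps `s₀ + 2δ` below `R`.
  set δ := min (ρ / 8) ((R - s₀) / 4) with hδ
  have hδ0 : 0 < δ := lt_min (by linarith) (by linarith [hs₀.2])
  have hδρ : δ ≤ ρ / 8 := min_le_left _ _
  have hδR : δ ≤ (R - s₀) / 4 := min_le_right _ _
  -- At `s₀ = 0` the interval starts at `s₀` and regularity is one-sided. On the right it extends to
  -- `s₀ + 2δ` because the regularity theorem gives nothing up to the last end point.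
  set a := max 0 (s₀ - δ) with ha
  have ha0 : 0 ≤ a := le_max_left _ _
  have haδ : s₀ - δ ≤ a := le_max_right _ _
  have has : a ≤ s₀ := max_le hs₀.1 (by linarith)
  have hsub : Icc a (s₀ + 2 * δ) ⊆ Ico 0 R := fun s hs =>
    ⟨ha0.trans hs.1, by linarith [hs.2, hs₀.2]⟩
  have hmin : IsMinimizingOn (chartMetric k x) (Metric.ball (φ x) ε) (K * (1 + 1 / κ)) (φ ∘ c)
      a (s₀ + 2 * δ) := by
    refine isMinimizingOn_extChartAt_comp x hG hεt (ρ := ρ / 8) (by linarith)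
      (fun s hs s' hs' => hc s (hsub hs) s' (hsub hs')) fun s hs q hq => hρU q ?_
    have h1 : metricEDist k x q ≤ metricEDist k x (c s) + metricEDist k (c s) q := by
      let := metricEMetricSpace k
      exact edist_triangle x (c s) q
    refine h1.trans_lt ?_
    rw [hx, hc s₀ hs₀ s (hsub hs)]
    refine (ENNReal.add_lt_add_left ENNReal.ofReal_ne_top hq).trans_le ?_
    rw [← ENNReal.ofReal_add (abs_nonneg _) (by linarith)]
    refine ENNReal.ofReal_le_ofReal ?_
    have h2 : |s₀ - s| ≤ 2 * δ := abs_le.2 ⟨by linarith [hs.2], by linarith [hs.1]⟩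
    linarith
  have hG' := hG.mono_distortion (K' := K * (1 + 1 / κ)) (by
    have h1 : 0 ≤ K * (1 / κ) := mul_nonneg hG.distortion_nonneg
      (one_div_pos.2 hG.ellipticity_pos).le
    linarith)
  have haβ : a < s₀ + δ := by linarith
  have hsm : ContDiffOn ℝ ∞ (φ ∘ c) (Icc a (s₀ + δ)) := hmin.contDiffOn hG' haβ (by linarith)
  have hsub' : Icc a (s₀ + δ) ⊆ Icc a (s₀ + 2 * δ) := Icc_subset_Icc_right (by linarith)
  have hmin' := hmin.mono hsub'
  have hs : s₀ ∈ Icc a (s₀ + δ) := ⟨has, by linarith⟩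
  have hsp := hmin'.speed_le haβ (hsm.differentiableOn (by simp)) hs
  have hsource : ∀ s ∈ Icc a (s₀ + δ), c s ∈ φ.source := by
    intro s hs
    refine (hρU _ ?_).1
    rw [hc s₀ hs₀ s (hsub (hsub' hs)), ENNReal.ofReal_lt_ofReal_iff hρ, abs_lt]
    exact ⟨by linarith [hs.2], by linarith [hs.1]⟩
  have heq : EqOn (φ.symm ∘ φ ∘ c) c (Icc a (s₀ + δ)) := fun s hs => φ.left_inv (hsource s hs)
  have hmt : MapsTo (φ ∘ c) (Icc a (s₀ + δ)) φ.target := fun s hs => φ.map_source (hsource s hs)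
  have hcs : ContMDiffOn 𝓘(ℝ, ℝ) 𝓘(ℝ, E) ∞ c (Icc a (s₀ + δ)) :=
    ((contMDiffOn_extChartAt_symm x).comp hsm.contMDiffOn hmt).congr fun s hs => (heq hs).symm
  have hset : (Icc a (s₀ + δ) : Set ℝ) =ᶠ[𝓝 s₀] Ico 0 R := by
    filter_upwards [Ioo_mem_nhds (show s₀ - δ < s₀ by linarith) (show s₀ < s₀ + δ by linarith)]
      with s hs
    refine propext ⟨fun h => hsub (hsub' h), fun h => ⟨max_le h.1 hs.1.le, hs.2.le⟩⟩
  refine ⟨(hcs s₀ hs).congr_set hset, ?_⟩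
  rw [← metricSpeed_congr_set hset, ← metricSpeed_congr heq hs,
    metricSpeed_extChartAt_symm_comp x (hsm.differentiableOn (by simp) s₀ hs)
    (uniqueDiffOn_Icc haβ s₀ hs) (hmt hs)]
  exact Real.sqrt_le_one.2 hsp

end Geodesics


/-! ### Causal curves of a standard static spacetime -/

section StaticCausality

open MeasureTheory

lemma Set.OrdConnected.uniqueDiffOn {J : Set ℝ} (hJ : J.OrdConnected) (hn : J.Nontrivial) :
    UniqueDiffOn ℝ J := by
  obtain ⟨a, ha, b, hb, hab⟩ := hn.exists_lt
  refine uniqueDiffOn_convex hJ.convex ⟨(a + b) / 2, ?_⟩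
  exact interior_maximal (Ioo_subset_Icc_self.trans (hJ.out ha hb)) isOpen_Ioo
    ⟨by linarith, by linarith⟩

variable {E : Type*} [NormedAddCommGroup E] [NormedSpace ℝ E]
  {S : Type*} [TopologicalSpace S] [ChartedSpace E S] [IsManifold 𝓘(ℝ, E) ∞ S]
  {k : ContMDiffRiemannianMetric 𝓘(ℝ, E) ∞ E (fun p : S => TangentSpace 𝓘(ℝ, E) p)}

lemma metricSpeed_const (p : S) (J : Set ℝ) (s : ℝ) : metricSpeed k (fun _ => p) J s = 0 := by
  rw [metricSpeed, mfderivWithin_const]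
  simp

lemma metricSpeed_comp_neg {c : ℝ → S} {J : Set ℝ} {s : ℝ}
    (hc : MDifferentiableWithinAt 𝓘(ℝ, ℝ) 𝓘(ℝ, E) c J (-s)) (hJ : UniqueDiffWithinAt ℝ (-J) s) :
    metricSpeed k (fun s => c (-s)) (-J) s = metricSpeed k c J (-s) := by
  have h1 : HasMFDerivWithinAt 𝓘(ℝ, ℝ) 𝓘(ℝ, ℝ) (fun s : ℝ => -s) (-J) s
      (-ContinuousLinearMap.id ℝ ℝ) :=
    ((hasFDerivAt_id s).neg.hasFDerivWithinAt).hasMFDerivWithinAt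
  have h2 := (HasMFDerivWithinAt.comp s hc.hasMFDerivWithinAt h1
    (fun r hr => by simpa using hr)).mfderivWithin hJ.uniqueMDiffWithinAt
  have h3 : (mfderivWithin 𝓘(ℝ, ℝ) 𝓘(ℝ, E) (fun s => c (-s)) (-J) s 1 : E) =
      -(mfderivWithin 𝓘(ℝ, ℝ) 𝓘(ℝ, E) c J (-s) 1 : E) := by
    have h4 := congrArg (fun L : ℝ →L[ℝ] E => L 1) h2
    refine h4.trans ?_
    exact map_neg (mfderivWithin 𝓘(ℝ, ℝ) 𝓘(ℝ, E) c J (-s) : ℝ →L[ℝ] E) (1 : ℝ)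
  have h5 : ∀ (p : S) (v : TangentSpace 𝓘(ℝ, E) p), k.inner p (-v) (-v) = k.inner p v v := by
    intro p v
    simp
  rw [metricSpeed, metricSpeed]
  refine congrArg Real.sqrt ?_
  refine Eq.trans ?_ (h5 (c (-s)) (mfderivWithin 𝓘(ℝ, ℝ) 𝓘(ℝ, E) c J (-s) 1))
  exact congrArg (fun v : E => k.inner (c (-s)) v v) h3

lemma metricSpeed_mono {c : ℝ → S} {J J' : Set ℝ} {s : ℝ} (h : J' ⊆ J)
    (hc : MDifferentiableWithinAt 𝓘(ℝ, ℝ) 𝓘(ℝ, E) c J s) (hJ : UniqueDiffWithinAt ℝ J' s) :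
    metricSpeed k c J' s = metricSpeed k c J s := by
  rw [metricSpeed, metricSpeed, mfderivWithin_subset h hJ.uniqueMDiffWithinAt hc]

/-- Elapsed time bounds the length of the spatial part, hence the distance it covers. -/
lemma metricEDist_le_of_metricSpeed_le_derivWithin {c : ℝ → S} {τ : ℝ → ℝ} {a b : ℝ} (hab : a ≤ b)
    (hc : ContMDiffOn 𝓘(ℝ, ℝ) 𝓘(ℝ, E) 1 c (Icc a b)) (hτ : ContDiffOn ℝ 1 τ (Icc a b))
    (h : ∀ s ∈ Icc a b, metricSpeed k c (Icc a b) s ≤ derivWithin τ (Icc a b) s) :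
    metricEDist k (c a) (c b) ≤ ENNReal.ofReal (τ b - τ a) := by
  rcases hab.eq_or_lt with rfl | hab'
  · exact (metricEDist_le_metricLength le_rfl hc).trans (by simp [metricLength])
  have hcont := hτ.continuousOn_derivWithin (uniqueDiffOn_Icc hab') le_rfl
  have h0 : ∀ s ∈ Icc a b, 0 ≤ derivWithin τ (Icc a b) s := fun s hs =>
    (Real.sqrt_nonneg _).trans (h s hs)
  calc metricEDist k (c a) (c b) ≤ metricLength k c a b := metricEDist_le_metricLength hab hc
    _ ≤ ∫⁻ s in Icc a b, ENNReal.ofReal (derivWithin τ (Icc a b) s) :=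
      setLIntegral_mono_ae' measurableSet_Icc
        (Eventually.of_forall fun s hs => ENNReal.ofReal_le_ofReal (h s hs))
    _ = ENNReal.ofReal (∫ s in a..b, derivWithin τ (Icc a b) s) := by
      rw [intervalIntegral.integral_of_le hab, ← integral_Icc_eq_integral_Ioc,
        ofReal_integral_eq_lintegral_ofReal (hcont.integrableOn_compact isCompact_Icc)]
      filter_upwards [ae_restrict_mem measurableSet_Icc] with s hs using h0 s hs
    _ = ENNReal.ofReal (τ b - τ a) := by
      rw [intervalIntegral.integral_derivWithin_Icc_of_contDiffOn_Icc hτ hab]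

variable {h : ContMDiffRiemannianMetric 𝓘(ℝ, E) ∞ E (fun p : S => TangentSpace 𝓘(ℝ, E) p)}
  {V : S → ℝ} (hV : ContMDiff 𝓘(ℝ, E) 𝓘(ℝ, ℝ) ∞ V) (hpos : ∀ p, 0 < V p)

lemma staticMetric_apply_of_mfderiv_eq {x : ℝ × S}
    {v w : TangentSpace (𝓘(ℝ, ℝ).prod 𝓘(ℝ, E)) x} {a b : ℝ} {v' w' : TangentSpace 𝓘(ℝ, E) x.2}
    (ha : mfderiv (𝓘(ℝ, ℝ).prod 𝓘(ℝ, E)) 𝓘(ℝ, ℝ) (Prod.fst : ℝ × S → ℝ) x v = a)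
    (hb : mfderiv (𝓘(ℝ, ℝ).prod 𝓘(ℝ, E)) 𝓘(ℝ, ℝ) (Prod.fst : ℝ × S → ℝ) x w = b)
    (hv : mfderiv (𝓘(ℝ, ℝ).prod 𝓘(ℝ, E)) 𝓘(ℝ, E) (Prod.snd : ℝ × S → S) x v = v')
    (hw : mfderiv (𝓘(ℝ, ℝ).prod 𝓘(ℝ, E)) 𝓘(ℝ, E) (Prod.snd : ℝ × S → S) x w = w') :
    staticMetric h V x v w = V x.2 ^ 2 * (a * b) - h.inner x.2 v' w' := by
  subst ha hb hv hw
  rfl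

omit [IsManifold 𝓘(ℝ, E) ∞ S] in
lemma mfderiv_fst_timeVectorField (x : ℝ × S) :
    mfderiv (𝓘(ℝ, ℝ).prod 𝓘(ℝ, E)) 𝓘(ℝ, ℝ) (Prod.fst : ℝ × S → ℝ) x (timeVectorField x) =
      (1 : ℝ) := by
  rw [timeVectorField, mfderiv_fst, mfderiv_prod_left]
  rfl

omit [IsManifold 𝓘(ℝ, E) ∞ S] in
lemma mfderiv_snd_timeVectorField (x : ℝ × S) :
    mfderiv (𝓘(ℝ, ℝ).prod 𝓘(ℝ, E)) 𝓘(ℝ, E) (Prod.snd : ℝ × S → S) x (timeVectorField x) =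
      (0 : E) := by
  rw [timeVectorField, mfderiv_snd, mfderiv_prod_left]
  rfl

/-- Future-pointing causal curves `(τ, c)` of a standard static spacetime: the time `τ` increases
at least at the speed of `c` for the conformal metric `V⁻² h`. -/
lemma isFutureCausalCurve_staticMetric_iff {γ : ℝ → ℝ × S} {J : Set ℝ} :
    IsFutureCausalCurve (𝓘(ℝ, ℝ).prod 𝓘(ℝ, E)) (staticMetric h V) timeVectorField γ J ↔
      J.OrdConnected ∧ J.Nontrivial ∧ ContDiffOn ℝ ∞ (fun s => (γ s).1) J ∧
      ContMDiffOn 𝓘(ℝ, ℝ) 𝓘(ℝ, E) ∞ (fun s => (γ s).2) J ∧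
      ∀ s ∈ J, 0 < derivWithin (fun s => (γ s).1) J s ∧
        metricSpeed (conformalMetric h V hV hpos) (fun s => (γ s).2) J s ≤
          derivWithin (fun s => (γ s).1) J s := by
  -- For the velocity `v` one has `g(v, ∂t) = V² τ'` and `g(v, v) = V² (τ'² - |c'|²)`, the norm
  -- being that of `V⁻² h`. Nonvanishing of `v` is automatic once `τ' > 0`.
  have key : ∀ (hJ : J.OrdConnected) (hn : J.Nontrivial)
      (hγ : ContMDiffOn 𝓘(ℝ, ℝ) (𝓘(ℝ, ℝ).prod 𝓘(ℝ, E)) ∞ γ J), ∀ s ∈ J,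
      (IsCausalVector (𝓘(ℝ, ℝ).prod 𝓘(ℝ, E)) (staticMetric h V)
        (mfderivWithin 𝓘(ℝ, ℝ) (𝓘(ℝ, ℝ).prod 𝓘(ℝ, E)) γ J s 1) ∧
      0 < staticMetric h V (γ s) (mfderivWithin 𝓘(ℝ, ℝ) (𝓘(ℝ, ℝ).prod 𝓘(ℝ, E)) γ J s 1)
        (timeVectorField (γ s))) ↔
      (0 < derivWithin (fun s => (γ s).1) J s ∧
        metricSpeed (conformalMetric h V hV hpos) (fun s => (γ s).2) J s ≤
          derivWithin (fun s => (γ s).1) J s) := by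
    intro hJ hn hγ s hs
    have hu := (hJ.uniqueDiffOn hn s hs).uniqueMDiffWithinAt
    have hd : MDifferentiableWithinAt 𝓘(ℝ, ℝ) (𝓘(ℝ, ℝ).prod 𝓘(ℝ, E)) γ J s :=
      (hγ s hs).mdifferentiableWithinAt (by simp)
    set v := mfderivWithin 𝓘(ℝ, ℝ) (𝓘(ℝ, ℝ).prod 𝓘(ℝ, E)) γ J s 1 with hv
    have h1 : mfderiv (𝓘(ℝ, ℝ).prod 𝓘(ℝ, E)) 𝓘(ℝ, ℝ) (Prod.fst : ℝ × S → ℝ) (γ s) v =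
        derivWithin (fun s => (γ s).1) J s := by
      rw [← fderivWithin_derivWithin, ← mfderivWithin_eq_fderivWithin]
      have := mfderiv_comp_mfderivWithin s (mdifferentiableAt_fst (x := γ s)) hd hu
      exact (congrArg (fun L : ℝ →L[ℝ] ℝ => L 1) this).symm
    have h2 : mfderiv (𝓘(ℝ, ℝ).prod 𝓘(ℝ, E)) 𝓘(ℝ, E) (Prod.snd : ℝ × S → S) (γ s) v =
        mfderivWithin 𝓘(ℝ, ℝ) 𝓘(ℝ, E) (fun s => (γ s).2) J s 1 := by
      have := mfderiv_comp_mfderivWithin s (mdifferentiableAt_snd (x := γ s)) hd hu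
      exact (congrArg (fun L : ℝ →L[ℝ] E => L 1) this).symm
    set τ' := derivWithin (fun s => (γ s).1) J s with hτ'
    have hVp := hpos (γ s).2
    have h3 : staticMetric h V (γ s) v (timeVectorField (γ s)) = V (γ s).2 ^ 2 * τ' := by
      rw [staticMetric_apply_of_mfderiv_eq (w' := 0) h1 (mfderiv_fst_timeVectorField _) h2
        (mfderiv_snd_timeVectorField _), map_zero, mul_one, sub_zero]
    have h4 : staticMetric h V (γ s) v v = V (γ s).2 ^ 2 * (τ' ^ 2 -
        metricSpeed (conformalMetric h V hV hpos) (fun s => (γ s).2) J s ^ 2) := by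
      have h5 : metricSpeed (conformalMetric h V hV hpos) (fun s => (γ s).2) J s ^ 2 =
          (V (γ s).2 ^ 2)⁻¹ * h.inner (γ s).2
            (mfderivWithin 𝓘(ℝ, ℝ) 𝓘(ℝ, E) (fun s => (γ s).2) J s 1)
            (mfderivWithin 𝓘(ℝ, ℝ) 𝓘(ℝ, E) (fun s => (γ s).2) J s 1) := by
        rw [metricSpeed]
        refine (Real.sq_sqrt ?_).trans rfl
        · rcases eq_or_ne (mfderivWithin 𝓘(ℝ, ℝ) 𝓘(ℝ, E) (fun s => (γ s).2) J s 1) 0 with h0 | h0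
          · rw [h0, map_zero]
          · exact ((conformalMetric h V hV hpos).pos _ _ h0).le
      rw [staticMetric_apply_of_mfderiv_eq h1 h1 h2 h2, h5]
      field_simp
    have h6 : 0 ≤ metricSpeed (conformalMetric h V hV hpos) (fun s => (γ s).2) J s :=
      Real.sqrt_nonneg _
    rw [IsCausalVector, h3, h4, mul_pos_iff_of_pos_left (by positivity),
      mul_nonneg_iff_of_pos_left (by positivity), sub_nonneg]
    constructor
    · rintro ⟨⟨-, h7⟩, h8⟩
      exact ⟨h8, (pow_le_pow_iff_left₀ h6 h8.le two_ne_zero).1 h7⟩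
    · rintro ⟨h8, h7⟩
      refine ⟨⟨fun h9 => ?_, (pow_le_pow_iff_left₀ h6 h8.le two_ne_zero).2 h7⟩, h8⟩
      rw [h9, map_zero] at h1
      exact h8.ne h1
  constructor
  · intro H
    refine ⟨H.ordConnected, H.nontrivial, ?_, ?_, fun s hs =>
      (key H.ordConnected H.nontrivial H.smooth s hs).1 ⟨H.causal s hs, H.future s hs⟩⟩
    · rw [← contMDiffOn_iff_contDiffOn]
      exact contMDiff_fst.comp_contMDiffOn H.smooth
    · exact contMDiff_snd.comp_contMDiffOn H.smooth
  · rintro ⟨hJ, hn, h1, h2, h3⟩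
    have hγ : ContMDiffOn 𝓘(ℝ, ℝ) (𝓘(ℝ, ℝ).prod 𝓘(ℝ, E)) ∞ γ J := h1.contMDiffOn.prodMk h2
    exact ⟨hJ, hn, hγ, fun s hs => ((key hJ hn hγ s hs).2 (h3 s hs)).1,
      fun s hs => ((key hJ hn hγ s hs).2 (h3 s hs)).2⟩

include hV hpos in
-- The reflection is an isometry that reverses the time-orientation; traversing the curve backwards
-- restores it.
lemma IsFutureCausalCurve.timeReflection {γ : ℝ → ℝ × S} {J : Set ℝ}
    (H : IsFutureCausalCurve (𝓘(ℝ, ℝ).prod 𝓘(ℝ, E)) (staticMetric h V) timeVectorField γ J) :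
    IsFutureCausalCurve (𝓘(ℝ, ℝ).prod 𝓘(ℝ, E)) (staticMetric h V) timeVectorField
      (fun s => timeReflection (γ (-s))) (-J) := by
  rw [isFutureCausalCurve_staticMetric_iff hV hpos] at H ⊢
  obtain ⟨hJ, hn, h1, h2, h3⟩ := H
  have hJ' : (-J).OrdConnected := by
    refine ⟨fun a ha b hb s hs => ?_⟩
    exact hJ.out hb ha ⟨neg_le_neg hs.2, neg_le_neg hs.1⟩
  have hn' : (-J).Nontrivial := by
    obtain ⟨a, ha, b, hb, hab⟩ := hn
    exact ⟨-a, by simpa, -b, by simpa, by simpa⟩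
  have hmaps : MapsTo (fun s : ℝ => -s) (-J) J := fun s hs => hs
  refine ⟨hJ', hn', ?_, ?_, fun s hs => ?_⟩
  · exact (h1.comp contDiff_neg.contDiffOn hmaps).neg
  · exact h2.comp contDiff_neg.contDiffOn.contMDiffOn hmaps
  · have hd : derivWithin (fun s => (_root_.timeReflection (γ (-s))).1) (-J) s =
        derivWithin (fun s => (γ s).1) J (-s) := by
      change derivWithin (fun s => -(γ (-s)).1) (-J) s = _
      rw [derivWithin.fun_neg, derivWithin_comp_neg (f := fun s => (γ s).1), neg_neg, neg_neg]
    rw [hd]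
    have hsp := metricSpeed_comp_neg (k := conformalMetric h V hV hpos)
      ((h2 (-s) hs).mdifferentiableWithinAt (by simp)) (hJ'.uniqueDiffOn hn' s hs)
    exact ⟨(h3 (-s) hs).1, hsp.le.trans (h3 (-s) hs).2⟩

end StaticCausality


/-! ### Cauchy developments of the static slice -/

section CauchyDevelopment

variable {E : Type*} [NormedAddCommGroup E] [NormedSpace ℝ E]
  {S : Type*} [TopologicalSpace S] [ChartedSpace E S]

lemma tendsto_neg_coe_atTop_atBot (J : Set ℝ) :
    Tendsto (fun s : J => (⟨-s, by simp⟩ : (-J : Set ℝ))) atTop atBot := by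
  refine tendsto_atBot.2 fun b => ?_
  filter_upwards [eventually_ge_atTop (⟨-b, b.2⟩ : J)] with s hs
  exact neg_le.1 (show -(b : ℝ) ≤ s from hs)

lemma tendsto_neg_coe_atBot_atTop (J : Set ℝ) :
    Tendsto (fun s : J => (⟨-s, by simp⟩ : (-J : Set ℝ))) atBot atTop := by
  refine tendsto_atTop.2 fun b => ?_
  filter_upwards [eventually_le_atBot (⟨-b, b.2⟩ : J)] with s hs
  exact le_neg.1 (show (s : ℝ) ≤ -(b : ℝ) from hs)

lemma continuous_timeReflection : Continuous (timeReflection : ℝ × S → ℝ × S) :=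
  continuous_fst.neg.prodMk continuous_snd

omit [TopologicalSpace S] in
lemma timeReflection_timeReflection (x : ℝ × S) : timeReflection (timeReflection x) = x := by
  simp [timeReflection]

lemma IsFutureInextendible.timeReflection {γ : ℝ → ℝ × S} {J : Set ℝ}
    (H : IsFutureInextendible γ J) :
    IsPastInextendible (fun s => timeReflection (γ (-s))) (-J) := by
  rintro ⟨q, hq⟩
  refine H ⟨_root_.timeReflection q, ?_⟩
  have := (continuous_timeReflection.tendsto q).comp (hq.comp (tendsto_neg_coe_atTop_atBot J))
  refine this.congr fun s => ?_
  simp [_root_.timeReflection]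

lemma IsPastInextendible.timeReflection {γ : ℝ → ℝ × S} {J : Set ℝ}
    (H : IsPastInextendible γ J) :
    IsFutureInextendible (fun s => timeReflection (γ (-s))) (-J) := by
  rintro ⟨q, hq⟩
  refine H ⟨_root_.timeReflection q, ?_⟩
  have := (continuous_timeReflection.tendsto q).comp (hq.comp (tendsto_neg_coe_atBot_atTop J))
  refine this.congr fun s => ?_
  simp [_root_.timeReflection]

omit [TopologicalSpace S] in
lemma timeReflection_mem_image {γ : ℝ → ℝ × S} {J : Set ℝ} {x : ℝ × S} (hx : x ∈ γ '' J) :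
    timeReflection x ∈ (fun s => timeReflection (γ (-s))) '' (-J) := by
  obtain ⟨s, hs, rfl⟩ := hx
  exact ⟨-s, by simpa using hs, by simp⟩

omit [TopologicalSpace S] in
lemma image_inter_zeroSlice_nonempty_of_timeReflection {γ : ℝ → ℝ × S} {J : Set ℝ}
    (H : ((fun s => timeReflection (γ (-s))) '' (-J) ∩ zeroSlice S).Nonempty) :
    (γ '' J ∩ zeroSlice S).Nonempty := by
  obtain ⟨-, ⟨s, hs, rfl⟩, h0⟩ := H
  exact ⟨γ (-s), ⟨-s, hs, rfl⟩, neg_eq_zero.1 h0⟩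

variable [IsManifold 𝓘(ℝ, E) ∞ S]
  {h : ContMDiffRiemannianMetric 𝓘(ℝ, E) ∞ E (fun p : S => TangentSpace 𝓘(ℝ, E) p)}
  {V : S → ℝ}

/-- Reflecting and reversing a curve exchanges past and future inextendibility and preserves meeting
the slice; since the reflection is an involution, both inclusions follow the same way. -/
lemma pastCauchyDevelopment_zeroSlice_eq_image (hV : ContMDiff 𝓘(ℝ, E) 𝓘(ℝ, ℝ) ∞ V)
    (hpos : ∀ p, 0 < V p) :
    pastCauchyDevelopment (𝓘(ℝ, ℝ).prod 𝓘(ℝ, E)) (staticMetric h V) timeVectorField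
        (zeroSlice S) =
      timeReflection '' futureCauchyDevelopment (𝓘(ℝ, ℝ).prod 𝓘(ℝ, E)) (staticMetric h V)
        timeVectorField (zeroSlice S) := by
  ext x
  constructor
  · intro hx
    refine ⟨timeReflection x, fun γ J hγ hJ hxγ => ?_, timeReflection_timeReflection x⟩
    refine image_inter_zeroSlice_nonempty_of_timeReflection
      (hx _ _ (hγ.timeReflection hV hpos) hJ.timeReflection ?_)
    have := timeReflection_mem_image hxγ
    rwa [timeReflection_timeReflection] at this
  · rintro ⟨y, hy, rfl⟩ γ J hγ hJ hxγ
    refine image_inter_zeroSlice_nonempty_of_timeReflection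
      (hy _ _ (hγ.timeReflection hV hpos) hJ.timeReflection ?_)
    have := timeReflection_mem_image hxγ
    rwa [timeReflection_timeReflection] at this

lemma metricClosedBall_eq_closedEBall [FiniteDimensional ℝ E] [T2Space S]
    (k : ContMDiffRiemannianMetric 𝓘(ℝ, E) ∞ E (fun p : S => TangentSpace 𝓘(ℝ, E) p))
    (p : S) (r : ℝ) :
    letI := metricEMetricSpace k
    metricClosedBall k p r = Metric.closedEBall p (ENNReal.ofReal r) := by
  let := metricEMetricSpace k
  ext q
  rw [Metric.mem_closedEBall, edist_comm]
  rfl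

/-- Through a point of negative time runs the vertical line restricted to negative times. It is
past-inextendible and misses the slice; its extendibility to the future is irrelevant. -/
lemma nonneg_of_mem_futureCauchyDevelopment (hV : ContMDiff 𝓘(ℝ, E) 𝓘(ℝ, ℝ) ∞ V)
    (hpos : ∀ p, 0 < V p) {x : ℝ × S}
    (hx : x ∈ futureCauchyDevelopment (𝓘(ℝ, ℝ).prod 𝓘(ℝ, E)) (staticMetric h V) timeVectorField
      (zeroSlice S)) : 0 ≤ x.1 := by
  by_contra! ht
  suffices H : IsFutureCausalCurve (𝓘(ℝ, ℝ).prod 𝓘(ℝ, E)) (staticMetric h V) timeVectorField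
      (fun s => (s, x.2)) (Iio 0) ∧ IsPastInextendible (fun s => (s, x.2)) (Iio 0) by
    obtain ⟨-, ⟨s, hs, rfl⟩, h0⟩ := hx _ _ H.1 H.2 ⟨x.1, ht, rfl⟩
    exact (mem_Iio.1 hs).ne h0
  constructor
  · rw [isFutureCausalCurve_staticMetric_iff hV hpos]
    refine ⟨ordConnected_Iio, ⟨-1, by simp, -2, by simp, by norm_num⟩, contDiffOn_id,
      contMDiffOn_const, fun s hs => ?_⟩
    have h1 : derivWithin (fun s : ℝ => s) (Iio 0) s = 1 :=
      derivWithin_id' s _ (isOpen_Iio.uniqueDiffOn s hs)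
    rw [metricSpeed_const]
    simp [h1]
  · rintro ⟨q, hq⟩
    have h1 : Tendsto (fun s : Iio (0 : ℝ) => (s : ℝ)) atBot (𝓝 q.1) :=
      (continuous_fst.tendsto q).comp hq
    have h2 : (min (q.1 - 1) (-1) : ℝ) ∈ Iio (0 : ℝ) :=
      (min_le_right (q.1 - 1) (-1)).trans_lt neg_one_lt_zero
    have : Nonempty (Iio (0 : ℝ)) := ⟨⟨_, h2⟩⟩
    have h3 : q.1 ≤ min (q.1 - 1) (-1) := le_of_tendsto h1 ((eventually_le_atBot
      (⟨_, h2⟩ : Iio (0 : ℝ))).mono fun s hs => hs)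
    linarith [min_le_left (q.1 - 1) (-1)]

/-- Lifting the nonconvergent minimizing ray of length `R ≤ x.1` to a causal curve gives one that
dies before reaching the slice. -/
lemma isCompact_metricClosedBall_of_mem_futureCauchyDevelopment [FiniteDimensional ℝ E]
    [T2Space S] (hV : ContMDiff 𝓘(ℝ, E) 𝓘(ℝ, ℝ) ∞ V) (hpos : ∀ p, 0 < V p) {x : ℝ × S}
    (hx : x ∈ futureCauchyDevelopment (𝓘(ℝ, ℝ).prod 𝓘(ℝ, E)) (staticMetric h V) timeVectorField
      (zeroSlice S)) :
    IsCompact (metricClosedBall (conformalMetric h V hV hpos) x.2 x.1) := by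
  set k := conformalMetric h V hV hpos with hk
  let := metricEMetricSpace k
  have : LocallyCompactSpace S := Manifold.locallyCompact_of_finiteDimensional 𝓘(ℝ, E)
  rw [metricClosedBall_eq_closedEBall]
  by_contra hnc
  have hk' := hasApproxIntermediatePoints_metricEMetricSpace k
  obtain ⟨R, hR, hRx, hlt, hRnc⟩ := hk'.exists_first_noncompact_radius hnc
  obtain ⟨c, hc0, hc, hclim⟩ := hk'.exists_ray hR hlt hRnc
  have hc' : ∀ s ∈ Ico 0 R, ∀ s' ∈ Ico 0 R, metricEDist k (c s) (c s') = ENNReal.ofReal |s - s'| :=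
    hc
  obtain ⟨hsm, hsp⟩ := contMDiffOn_of_metricEDist_eq hc'
  have hneg : -Ico 0 R = Ioc (-R) 0 := by
    ext s
    simp only [Set.mem_neg, mem_Ico, mem_Ioc]
    constructor <;> rintro ⟨h1, h2⟩ <;> constructor <;> linarith
  have hmaps : MapsTo (fun s : ℝ => -s) (Ioc (-R) 0) (Ico 0 R) := by
    intro s hs
    rw [← hneg] at hs
    exact hs
  have hu : UniqueDiffOn ℝ (Ioc (-R) 0) := uniqueDiffOn_Ioc _ _
  -- The ray is run backwards over `(-R, 0]`, ending at `x`. As `-R` is excluded, the time `x.1 + s`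
  -- exceeds `x.1 - R ≥ 0` strictly, even when `R = x.1`.
  suffices H : IsFutureCausalCurve (𝓘(ℝ, ℝ).prod 𝓘(ℝ, E)) (staticMetric h V) timeVectorField
      (fun s => (x.1 + s, c (-s))) (Ioc (-R) 0) ∧
      IsPastInextendible (fun s => (x.1 + s, c (-s))) (Ioc (-R) 0) by
    obtain ⟨-, ⟨s, hs, rfl⟩, h0⟩ := hx _ _ H.1 H.2 ⟨0, ⟨by linarith, le_rfl⟩, by simp [hc0]⟩
    have h0' : x.1 + s = 0 := h0
    linarith [hs.1]
  constructor
  · rw [isFutureCausalCurve_staticMetric_iff hV hpos]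
    refine ⟨ordConnected_Ioc, ⟨0, ⟨by linarith, le_rfl⟩, -(R / 2), ⟨by linarith, by linarith⟩,
      by linarith⟩, (contDiff_const.add contDiff_id).contDiffOn,
      hsm.comp contDiff_neg.contDiffOn.contMDiffOn hmaps, fun s hs => ?_⟩
    have h1 : derivWithin (fun s : ℝ => x.1 + s) (Ioc (-R) 0) s = 1 :=
      ((hasDerivAt_id s).const_add x.1).hasDerivWithinAt.derivWithin (hu s hs)
    have h2 := metricSpeed_comp_neg (k := k) (s := s) (J := Ico 0 R) (c := c)
      ((hsm (-s) (hmaps hs)).mdifferentiableWithinAt (by simp)) (by rw [hneg]; exact hu s hs)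
    rw [hneg] at h2
    simp only [h1]
    exact ⟨one_pos, h2.le.trans (hsp _ (hmaps hs))⟩
  · rintro ⟨q, hq⟩
    refine hclim ⟨q.2, ?_⟩
    have h1 : Tendsto (fun s : Ioc (-R) 0 => c (-s)) atBot (𝓝 q.2) :=
      (continuous_snd.tendsto q).comp hq
    have h2 : map ((↑) : Ioc (-R) 0 → ℝ) atBot = 𝓝[>] (-R) :=
      map_coe_atBot_of_Ioo_subset Ioc_subset_Ioi_self
        fun _ _ => ⟨0, by simpa using hR, Ioo_subset_Ioc_self⟩
    have h3 : Tendsto (fun s : ℝ => c (-s)) (𝓝[>] (-R)) (𝓝 q.2) := by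
      rw [← h2]
      exact tendsto_map'_iff.2 h1
    have h4 : Tendsto (fun s : ℝ => -s) (𝓝[<] R) (𝓝[>] (-R)) := tendsto_neg_nhdsLT
    refine (h3.comp h4).congr fun s => ?_
    simp

/-- A causal curve avoiding the slice has time bounded below towards the past. Its spatial part is
then Cauchy in a compact ball, so the curve has a past limit. -/
lemma mem_futureCauchyDevelopment_of_isCompact_metricClosedBall [FiniteDimensional ℝ E]
    [T2Space S] (hV : ContMDiff 𝓘(ℝ, E) 𝓘(ℝ, ℝ) ∞ V) (hpos : ∀ p, 0 < V p) {x : ℝ × S}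
    (hx : 0 ≤ x.1) (hc : IsCompact (metricClosedBall (conformalMetric h V hV hpos) x.2 x.1)) :
    x ∈ futureCauchyDevelopment (𝓘(ℝ, ℝ).prod 𝓘(ℝ, E)) (staticMetric h V) timeVectorField
      (zeroSlice S) := by
  set k := conformalMetric h V hV hpos with hk
  let := metricEMetricSpace k
  rintro γ J hγ hJ ⟨s₁, hs₁, rfl⟩
  rw [isFutureCausalCurve_staticMetric_iff hV hpos] at hγ
  obtain ⟨hoc, hn, hτ, hcs, hsp⟩ := hγ
  by_contra hne
  set τ : ℝ → ℝ := fun s => (γ s).1 with hτdef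
  set c : ℝ → S := fun s => (γ s).2 with hcdef
  have hτ0 : ∀ s ∈ J, τ s ≠ 0 := fun s hs h0 => hne ⟨γ s, ⟨s, hs, rfl⟩, h0⟩
  have hdist : ∀ s ∈ J, ∀ s' ∈ J, s ≤ s' →
      τ s ≤ τ s' ∧ edist (c s) (c s') ≤ ENNReal.ofReal (τ s' - τ s) := by
    intro s hs s' hs' hss
    rcases hss.eq_or_lt with rfl | hlt
    · simp
    have hsub : Icc s s' ⊆ J := hoc.out hs hs'
    have hu := uniqueDiffOn_Icc hlt
    have hτ1 : ContDiffOn ℝ 1 τ (Icc s s') := (hτ.mono hsub).of_le (by simp)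
    have hd : ∀ r ∈ Icc s s', derivWithin τ (Icc s s') r = derivWithin τ J r := fun r hr =>
      derivWithin_subset hsub (hu r hr) (hτ.differentiableOn (by simp) r (hsub hr))
    refine ⟨?_, ?_⟩
    · rw [← sub_nonneg, ← intervalIntegral.integral_derivWithin_Icc_of_contDiffOn_Icc hτ1 hss]
      refine intervalIntegral.integral_nonneg hss fun r hr => ?_
      rw [hd r hr]
      exact (hsp r (hsub hr)).1.le
    · refine metricEDist_le_of_metricSpeed_le_derivWithin (k := k) hss
        ((hcs.mono hsub).of_le (by simp)) hτ1 fun r hr => ?_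
      rw [hd r hr, metricSpeed_mono hsub
        ((hcs r (hsub hr)).mdifferentiableWithinAt (by simp)) (hu r hr)]
      exact (hsp r (hsub hr)).2
  -- The time never vanishes on the connected set `J` and is nonnegative at `s₁`, so it is positive
  -- throughout.
  have hpos : ∀ s ∈ J, 0 < τ s := by
    intro s hs
    by_contra! hle
    obtain ⟨r, hr, hr0⟩ := hoc.isPreconnected.intermediate_value hs hs₁ hτ.continuousOn ⟨hle, hx⟩
    exact hτ0 r hr hr0
  have hJne : Nonempty J := ⟨⟨s₁, hs₁⟩⟩
  have hbdd : BddBelow (range fun s : J => τ s) :=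
    ⟨0, by rintro - ⟨s, rfl⟩; exact (hpos s s.2).le⟩
  have hτlim : Tendsto (fun s : J => τ s) atBot (𝓝 (⨅ s : J, τ s)) :=
    tendsto_atBot_ciInf (fun s s' hss => (hdist s s.2 s' s'.2 hss).1) hbdd
  have hball : ∀ᶠ s : J in atBot, c s ∈ metricClosedBall k (c s₁) (τ s₁) := by
    filter_upwards [eventually_le_atBot (⟨s₁, hs₁⟩ : J)] with s hs
    have h1 := (hdist s s.2 s₁ hs₁ hs).2
    rw [edist_comm] at h1
    exact h1.trans (ENNReal.ofReal_le_ofReal (by linarith [hpos s s.2]))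
  -- The monotone function `τ` converges to its infimum, and its increments dominate the distances
  -- along `c`.
  have hcauchy : Cauchy (map (fun s : J => c s) atBot) := by
    refine EMetric.cauchy_iff.2 ⟨NeBot.ne inferInstance, fun ε hε => ?_⟩
    obtain ⟨δ, h0, hδ⟩ := ENNReal.lt_iff_exists_real_btwn.1 hε
    have hδ0 : 0 < δ := by simpa using hδ.1
    obtain ⟨s₂, hs₂⟩ := (hτlim.eventually_lt_const (lt_add_of_pos_right _ hδ0)).exists
    have hinf : ∀ s : J, (⨅ r : J, τ r) ≤ τ s := fun s => ciInf_le hbdd s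
    have hlt : ∀ s s' : J, s ≤ s' → s' ≤ s₂ → edist (c s) (c s') < ε := by
      intro s s' hss hs'
      refine (hdist s s.2 s' s'.2 hss).2.trans_lt (lt_of_le_of_lt ?_ hδ.2)
      refine ENNReal.ofReal_le_ofReal ?_
      linarith [hinf s, (hdist s' s'.2 s₂ s₂.2 hs').1]
    refine ⟨(fun s : J => c s) '' Iic s₂, image_mem_map (Iic_mem_atBot s₂), ?_⟩
    rintro - ⟨s, hs, rfl⟩ - ⟨s', hs', rfl⟩
    rcases le_total s s' with hss | hss
    · exact hlt s s' hss hs'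
    · rw [edist_comm]
      exact hlt s' s hss hs
  obtain ⟨q, -, hq⟩ := hc.isComplete _ hcauchy (le_principal_iff.2 hball)
  exact hJ ⟨(⨅ s : J, τ s, q), (hτlim.prodMk_nhds hq)⟩

end CauchyDevelopment

/-! ### The Cauchy developments and openness -/

theorem mainTheorem8
    {E : Type*} [NormedAddCommGroup E] [NormedSpace ℝ E] [FiniteDimensional ℝ E]
    {S : Type*} [TopologicalSpace S] [T2Space S] [ChartedSpace E S] [IsManifold 𝓘(ℝ, E) ∞ S]
    (h : ContMDiffRiemannianMetric 𝓘(ℝ, E) ∞ E (fun p : S => TangentSpace 𝓘(ℝ, E) p))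
    (V : S → ℝ) (hV : ContMDiff 𝓘(ℝ, E) 𝓘(ℝ, ℝ) ∞ V) (hpos : ∀ p, 0 < V p) :
    -- the future Cauchy development
    (futureCauchyDevelopment (𝓘(ℝ, ℝ).prod 𝓘(ℝ, E)) (staticMetric h V) timeVectorField
        (zeroSlice S) =
      {x : ℝ × S | 0 ≤ x.1 ∧ IsCompact (metricClosedBall (conformalMetric h V hV hpos) x.2 x.1)}) ∧
    -- the past Cauchy development
    (pastCauchyDevelopment (𝓘(ℝ, ℝ).prod 𝓘(ℝ, E)) (staticMetric h V) timeVectorField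
        (zeroSlice S) =
      {x : ℝ × S | ∃ (t : ℝ) (p : S), x = (-t, p) ∧ 0 ≤ t ∧
        IsCompact (metricClosedBall (conformalMetric h V hV hpos) p t)} ∧
    pastCauchyDevelopment (𝓘(ℝ, ℝ).prod 𝓘(ℝ, E)) (staticMetric h V) timeVectorField
        (zeroSlice S) =
      timeReflection '' futureCauchyDevelopment (𝓘(ℝ, ℝ).prod 𝓘(ℝ, E)) (staticMetric h V) timeVectorField
        (zeroSlice S)) ∧
    -- the Cauchy development
    (cauchyDevelopment (𝓘(ℝ, ℝ).prod 𝓘(ℝ, E)) (staticMetric h V) timeVectorField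
        (zeroSlice S) =
      futureCauchyDevelopment (𝓘(ℝ, ℝ).prod 𝓘(ℝ, E)) (staticMetric h V) timeVectorField
        (zeroSlice S) ∪
      pastCauchyDevelopment (𝓘(ℝ, ℝ).prod 𝓘(ℝ, E)) (staticMetric h V) timeVectorField
        (zeroSlice S) ∧
    cauchyDevelopment (𝓘(ℝ, ℝ).prod 𝓘(ℝ, E)) (staticMetric h V) timeVectorField
        (zeroSlice S) =
      {x : ℝ × S | IsCompact (metricClosedBall (conformalMetric h V hV hpos) x.2 |x.1|)}) ∧
    -- openness
    IsOpen (cauchyDevelopment (𝓘(ℝ, ℝ).prod 𝓘(ℝ, E)) (staticMetric h V) timeVectorField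
        (zeroSlice S)) := by
  have hfut : futureCauchyDevelopment (𝓘(ℝ, ℝ).prod 𝓘(ℝ, E)) (staticMetric h V)
      timeVectorField (zeroSlice S) = {x : ℝ × S | 0 ≤ x.1 ∧
        IsCompact (metricClosedBall (conformalMetric h V hV hpos) x.2 x.1)} := by
    ext x
    exact ⟨fun hx => ⟨nonneg_of_mem_futureCauchyDevelopment hV hpos hx,
      isCompact_metricClosedBall_of_mem_futureCauchyDevelopment hV hpos hx⟩,
      fun hx => mem_futureCauchyDevelopment_of_isCompact_metricClosedBall hV hpos hx.1 hx.2⟩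
  have himage := pastCauchyDevelopment_zeroSlice_eq_image (h := h) hV hpos
  have hpast : pastCauchyDevelopment (𝓘(ℝ, ℝ).prod 𝓘(ℝ, E)) (staticMetric h V)
      timeVectorField (zeroSlice S) = {x : ℝ × S | ∃ (t : ℝ) (p : S), x = (-t, p) ∧ 0 ≤ t ∧
        IsCompact (metricClosedBall (conformalMetric h V hV hpos) p t)} := by
    rw [himage, hfut]
    ext x
    constructor
    · rintro ⟨y, hy, rfl⟩
      exact ⟨y.1, y.2, rfl, hy⟩
    · rintro ⟨t, p, rfl, hp⟩
      exact ⟨(t, p), hp, rfl⟩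
  have hdev : cauchyDevelopment (𝓘(ℝ, ℝ).prod 𝓘(ℝ, E)) (staticMetric h V)
      timeVectorField (zeroSlice S) = {x : ℝ × S |
        IsCompact (metricClosedBall (conformalMetric h V hV hpos) x.2 |x.1|)} := by
    rw [cauchyDevelopment, hfut, hpast]
    ext x
    constructor
    · rintro (⟨hx, hc⟩ | ⟨t, p, rfl, ht, hc⟩)
      · rwa [mem_ofPred_eq, abs_of_nonneg hx]
      · rwa [mem_ofPred_eq, abs_neg, abs_of_nonneg ht]
    · intro hc
      rw [mem_ofPred_eq] at hc
      rcases le_total 0 x.1 with hx | hx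
      · rw [abs_of_nonneg hx] at hc
        exact Or.inl ⟨hx, hc⟩
      · rw [abs_of_nonpos hx] at hc
        exact Or.inr ⟨-x.1, x.2, by simp, by linarith, hc⟩
  refine ⟨hfut, ⟨hpast, himage⟩, ⟨rfl, hdev⟩, ?_⟩
  rw [hdev]
  let := metricEMetricSpace (conformalMetric h V hV hpos)
  have : LocallyCompactSpace S := Manifold.locallyCompact_of_finiteDimensional 𝓘(ℝ, E)
  simp only [metricClosedBall_eq_closedEBall]
  exact (hasApproxIntermediatePoints_metricEMetricSpace
    (conformalMetric h V hV hpos)).isOpen_setOf_isCompact_closedEBall
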